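/- Let $n\ge 2$ be even, let $\Omega\subset\mathbb R^n$ be an open set (for instance a convex domain with smooth boundary), let $f\in C_c^\infty(\Omega)$, $x\in\partial\Omega$ and $v\in\mathbb R^n$. Let $u\colon\mathbb R^n\times[0,\infty)\to\mathbb R$ be the classical solution ($C^2$ on $\mathbb R^n\times(0,\infty)$ and $C^1$ on $\mathbb R^n\times[0,\infty)$) of the wave equation $\partial_t^2u-\Delta u=0$ on $\mathbb R^n\times(0,\infty)$ with $u(\cdot,0)=f$ and $\partial_tu(\cdot,0)=0$. Write $$\mathcal Mf(x,r)=\frac1{n\omega_n}\int_{\mathbb S^{n-1}}f(x+ry)\,d\sigma(y)$$ for the spherical means of $f$, where $\omega_n$ is the volume of the unit ball and $\sigma$ the surface measure on the unit sphere $\mathbb S^{n-1}$; let $D_v$ be the directional derivative along $v$ in the spatial variable, and put $\gamma_n=2\cdot4\cdots(n-2)\cdot n$. Operators act on everything to their right; $\partial_tt^{-1}$ is the operator $h\mapsto\partial_t(t^{-1}h(t))$. Then $\mathcal Mf(\cdot,r)$ and $u(\cdot,t)$ are differentiable at $x$ along $v$ for all $r,t>0$, the functions $\mathcal Mf(x,\cdot)$,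 $D_v\mathcal Mf(x,\cdot)$, $u(x,\cdot)$ and $D_vu(x,\cdot)$ are smooth on $(0,\infty)$, and for every $r>0$ the integrals below converge absolutely and $$\Bigl(\frac1r\partial_r\Bigr)^{\frac{n-2}2}r^{n-2}\mathcal Mf(x,r)=\frac{2\gamma_n}{\pi n}\int_0^r\frac{u(x,t)}{\sqrt{r^2-t^2}}\,dt,$$ $$\Bigl(\frac1r\partial_r\Bigr)^{\frac{n-2}2}r^{n-2}D_v\mathcal Mf(x,r)=\frac{2\gamma_n}{\pi n}\int_0^r\frac{D_vu(x,t)}{\sqrt{r^2-t^2}}\,dt,$$ $$\Bigl(\frac1r\partial_r\Bigr)^{n-2}r^{n-2}\mathcal Mf(x,r)=\frac{2\gamma_n}{\pi n}\int_0^r\frac{(\partial_tt^{-1})^{\frac{n-2}2}u(x,t)}{\sqrt{r^2-t^2}}\,dt,$$ $$\Bigl(\frac1r\partial_r\Bigr)^{n-2}r^{n-2}D_v\mathcal Mf(x,r)=\frac{2\gamma_n}{\pi n}\int_0^r\frac{(\partial_tt^{-1})^{\frac{n-2}2}D_vu(x,t)}{\sqrt{r^2-t^2}}\,dt.$$ 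-/

import Mathlib

open MeasureTheory Set
open scoped ContDiff Laplacian Nat

noncomputable section

namespace WaveAbel

/-- The spherical mean `(n ω_n)⁻¹ ∫_{S^{n-1}} f (x + r y) dσ(y)`, where `ω_n` is the volume of the
unit ball and `σ` the (unnormalised) surface measure of the unit sphere. -/
def sphericalMean {n : ℕ} (f : EuclideanSpace ℝ (Fin n) → ℝ) (x : EuclideanSpace ℝ (Fin n))
    (r : ℝ) : ℝ :=
  ((n : ℝ) * volume.real (Metric.ball (0 : EuclideanSpace ℝ (Fin n)) 1))⁻¹ *
    ∫ y : Metric.sphere (0 : EuclideanSpace ℝ (Fin n)) 1, f (x + r • (y : EuclideanSpace ℝ (Fin n)))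
      ∂((volume : Measure (EuclideanSpace ℝ (Fin n))).toSphere)

/-- The directional derivative `D_v F(x,t)` in the spatial variable of a function of `(x,t)`. -/
def spatialDeriv {n : ℕ} (v : EuclideanSpace ℝ (Fin n))
    (F : EuclideanSpace ℝ (Fin n) → ℝ → ℝ) (x : EuclideanSpace ℝ (Fin n)) (t : ℝ) : ℝ :=
  lineDeriv ℝ (fun y => F y t) x v

/-- The operator `r⁻¹ ∂_r`. -/
def invMulDeriv (h : ℝ → ℝ) (r : ℝ) : ℝ := r⁻¹ * deriv h r

/-- The operator `∂_t t⁻¹`, that is, `h ↦ ∂_t (t⁻¹ h(t))`. -/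
def derivInvMul (h : ℝ → ℝ) (t : ℝ) : ℝ := deriv (fun s => s⁻¹ * h s) t

/-- `u` is a classical solution on `ℝⁿ × [0,∞)` of the wave equation `∂_t² u = Δ u` with initial
data `(f,g)`. Values of `u` at negative times play no role. -/
structure IsWaveSolution {n : ℕ} (f g : EuclideanSpace ℝ (Fin n) → ℝ)
    (u : EuclideanSpace ℝ (Fin n) → ℝ → ℝ) : Prop where
  contDiffOn_two : ContDiffOn ℝ 2 (fun p : EuclideanSpace ℝ (Fin n) × ℝ => u p.1 p.2)
    (univ ×ˢ Ioi (0 : ℝ))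
  contDiffOn_one : ContDiffOn ℝ 1 (fun p : EuclideanSpace ℝ (Fin n) × ℝ => u p.1 p.2)
    (univ ×ˢ Ici (0 : ℝ))
  wave_eq : ∀ x, ∀ t, 0 < t → iteratedDeriv 2 (u x) t - Δ (fun y => u y t) x = 0
  initial_value : ∀ x, u x 0 = f x
  initial_velocity : ∀ x, derivWithin (u x) (Ici 0) 0 = g x

end WaveAbel

end

/-!
Each spherical mean of the initial value is an average of the wave along the time axis,
`Mf(x, r) = c ∫_0^{π/2} u(x, r sin θ) (cos θ)^{n-2} dθ`.
If `u` is a superposition of standing waves `cos (2π t ‖ξ‖) exp (2π i ⟨x, ξ⟩)`, this has to be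
checked for a single frequency `ξ` only, where both sides are power series in `r ‖ξ‖` whose
coefficients are moments of the unit sphere and of `sin θ` obeying the same recursion. The energy in
a backward light cone does not increase, so in every cone `u` coincides with the superposition
launched by a smooth cutoff of `f`. Hence the identity holds for `u` as well, and the even extension
of `u` in time is smooth and, for `x` outside the support of `f`, vanishes near `(x, 0)`.

Integration by parts in `θ` shows that each `r⁻¹ ∂_r` applied to the average lowers the power of
`cos θ` by two; after `(n - 2) / 2` of them the average is an Abel transform. When `u(x, ·)`
vanishes near `0`, a further `r⁻¹ ∂_r` passes under the Abel transform as `∂_t t⁻¹`. The identities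
for `D_v` follow in the same way, since averaging in time commutes with `D_v`.
-/

namespace WaveAbel

open Real Filter Function
open scoped Topology FourierTransform InnerProductSpace

section ParametricIntegral

theorem hasDerivAt_intervalIntegral_of_continuous {E : Type*} [NormedAddCommGroup E]
    [NormedSpace ℝ E] {G G' : ℝ → ℝ → E} (hG : ∀ s, Continuous (G s))
    (hG' : Continuous (uncurry G')) (hderiv : ∀ s θ, HasDerivAt (fun s => G s θ) (G' s θ) s)
    (a b r : ℝ) :
    HasDerivAt (fun s => ∫ θ in a..b, G s θ) (∫ θ in a..b, G' r θ) r := by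
  obtain ⟨C, hC⟩ := ((isCompact_closedBall r (1 : ℝ)).prod
    (isCompact_uIcc (a := a) (b := b))).exists_bound_of_continuousOn hG'.continuousOn
  refine (intervalIntegral.hasDerivAt_integral_of_dominated_loc_of_deriv_le
    (bound := fun _ => C) (Metric.ball_mem_nhds r one_pos)
    (.of_forall fun s => (hG s).aestronglyMeasurable) ((hG r).intervalIntegrable a b)
    (by fun_prop) (.of_forall fun θ hθ s hs => ?_) intervalIntegrable_const
    (.of_forall fun θ _ s _ => hderiv s θ)).2
  exact hC (s, θ) ⟨Metric.ball_subset_closedBall hs, uIoc_subset_uIcc hθ⟩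

theorem hasDerivAt_integral_comp_mul_sin {h w : ℝ → ℝ} (hh : ContDiff ℝ 1 h) (hw : Continuous w)
    (a b r : ℝ) :
    HasDerivAt (fun r => ∫ θ in a..b, h (r * sin θ) * w θ)
      (∫ θ in a..b, deriv h (r * sin θ) * (sin θ * w θ)) r := by
  have : Continuous (deriv h) := hh.continuous_deriv le_rfl
  have hc := hh.continuous
  refine hasDerivAt_intervalIntegral_of_continuous
    (G := fun r θ => h (r * sin θ) * w θ)
    (G' := fun r θ => deriv h (r * sin θ) * (sin θ * w θ))
    (fun s => by fun_prop) (by fun_prop) (fun s θ => ?_) a b r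
  have hdiff := (hh.differentiable one_ne_zero (s * sin θ)).hasDerivAt
  simpa [mul_assoc] using (hdiff.comp s (hasDerivAt_mul_const (sin θ))).mul_const (w θ)

theorem contDiff_integral_comp_mul_sin {h w : ℝ → ℝ} (hh : ContDiff ℝ ∞ h) (hw : Continuous w)
    (a b : ℝ) : ContDiff ℝ ∞ (fun r => ∫ θ in a..b, h (r * sin θ) * w θ) := by
  refine contDiff_infty.2 fun k => ?_
  induction k generalizing h w with
  | zero =>
    have hc := hh.continuous
    exact contDiff_zero.2 (intervalIntegral.continuous_parametric_intervalIntegral_of_continuous'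
      (by fun_prop) a b)
  | succ k ih =>
    have hderiv := hasDerivAt_integral_comp_mul_sin (hh.of_le (by simp)) hw a b
    refine (contDiff_succ_iff_deriv (n := k)).2 ⟨fun r => (hderiv r).differentiableAt, by simp, ?_⟩
    rw [funext fun r => (hderiv r).deriv]
    exact ih (contDiff_infty_iff_deriv.1 hh).2 (by fun_prop)

theorem hasLineDerivAt_integral_comp_mul_sin {V : Type*} [NormedAddCommGroup V] [NormedSpace ℝ V]
    {w : V × ℝ → ℝ} (hw : ContDiff ℝ 1 w) {c : ℝ → ℝ} (hc : Continuous c) (a b r : ℝ) (x v : V) :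
    HasLineDerivAt ℝ (fun y => ∫ θ in a..b, w (y, r * sin θ) * c θ)
      (∫ θ in a..b, fderiv ℝ w (x, r * sin θ) (v, 0) * c θ) x v := by
  have : Continuous (fderiv ℝ w) := hw.continuous_fderiv one_ne_zero
  have hwc := hw.continuous
  have key := hasDerivAt_intervalIntegral_of_continuous
    (G := fun s θ => w (x + s • v, r * sin θ) * c θ)
    (G' := fun s θ => fderiv ℝ w (x + s • v, r * sin θ) (v, 0) * c θ)
    (fun s => by fun_prop) (by fun_prop) (fun s θ => ?_) a b 0
  · simpa only [HasLineDerivAt, zero_smul, add_zero] using key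
  have hpath : HasDerivAt (fun s : ℝ => (x + s • v, r * sin θ)) (v, (0 : ℝ)) s := by
    simpa using (((hasDerivAt_id s).smul_const v).const_add x).prodMk
      (hasDerivAt_const s (r * sin θ))
  exact ((hw.differentiable one_ne_zero _).hasFDerivAt.comp_hasDerivAt s hpath).mul_const (c θ)

end ParametricIntegral

section Operators

theorem invMulDeriv_eqOn {g h : ℝ → ℝ} {S : Set ℝ} (hS : IsOpen S) (hgh : EqOn g h S) :
    EqOn (invMulDeriv g) (invMulDeriv h) S := fun r hr => by
  simp only [invMulDeriv, (hgh.eventuallyEq_of_mem (hS.mem_nhds hr)).deriv_eq]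

theorem derivInvMul_eqOn {g h : ℝ → ℝ} {S : Set ℝ} (hS : IsOpen S) (hgh : EqOn g h S) :
    EqOn (derivInvMul g) (derivInvMul h) S := fun _ hr =>
  ((EventuallyEq.refl _ _).fun_mul (hgh.eventuallyEq_of_mem (hS.mem_nhds hr))).deriv_eq

theorem iterate_invMulDeriv_eqOn {g h : ℝ → ℝ} {S : Set ℝ} (hS : IsOpen S) (hgh : EqOn g h S)
    (k : ℕ) : EqOn (invMulDeriv^[k] g) (invMulDeriv^[k] h) S := by
  induction k generalizing g h with
  | zero => exact hgh
  | succ _ ih => exact ih (invMulDeriv_eqOn hS hgh)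

theorem iterate_derivInvMul_eqOn {g h : ℝ → ℝ} {S : Set ℝ} (hS : IsOpen S) (hgh : EqOn g h S)
    (k : ℕ) : EqOn (derivInvMul^[k] g) (derivInvMul^[k] h) S := by
  induction k generalizing g h with
  | zero => exact hgh
  | succ _ ih => exact ih (derivInvMul_eqOn hS hgh)

theorem iterate_invMulDeriv_const_mul (c : ℝ) (g : ℝ → ℝ) (k : ℕ) :
    invMulDeriv^[k] (fun s => c * g s) = fun s => c * (invMulDeriv^[k] g) s := by
  induction k generalizing g with
  | zero => rfl
  | succ k ih =>
    have hstep : invMulDeriv (fun s => c * g s) = fun s => c * invMulDeriv g s := by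
      funext s
      simp only [invMulDeriv, deriv_const_mul_field, mul_left_comm]
    rw [iterate_succ_apply, hstep, ih, iterate_succ_apply]

variable {h : ℝ → ℝ}

theorem inv_mul_eventuallyEq_zero (h0 : h =ᶠ[𝓝 0] 0) : (fun s => s⁻¹ * h s) =ᶠ[𝓝 0] 0 := by
  filter_upwards [h0] with s hs
  simp [hs]

theorem contDiff_inv_mul (hh : ContDiff ℝ ∞ h) (h0 : h =ᶠ[𝓝 0] 0) :
    ContDiff ℝ ∞ (fun s => s⁻¹ * h s) := by
  refine contDiff_iff_contDiffAt.2 fun s => ?_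
  rcases eq_or_ne s 0 with rfl | hs
  · exact contDiffAt_const.congr_of_eventuallyEq (inv_mul_eventuallyEq_zero h0)
  · exact (contDiffAt_inv ℝ hs).mul hh.contDiffAt

theorem contDiff_derivInvMul (hh : ContDiff ℝ ∞ h) (h0 : h =ᶠ[𝓝 0] 0) :
    ContDiff ℝ ∞ (derivInvMul h) :=
  (contDiff_infty_iff_deriv.1 (contDiff_inv_mul hh h0)).2

theorem derivInvMul_eventuallyEq_zero (h0 : h =ᶠ[𝓝 0] 0) : derivInvMul h =ᶠ[𝓝 0] 0 := by
  filter_upwards [(inv_mul_eventuallyEq_zero h0).eventuallyEq_nhds] with s hs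
  simpa [derivInvMul, Pi.zero_def] using hs.deriv_eq

theorem contDiff_iterate_derivInvMul (hh : ContDiff ℝ ∞ h) (h0 : h =ᶠ[𝓝 0] 0) (k : ℕ) :
    ContDiff ℝ ∞ (derivInvMul^[k] h) := by
  induction k generalizing h with
  | zero => exact hh
  | succ _ ih => exact ih (contDiff_derivInvMul hh h0) (derivInvMul_eventuallyEq_zero h0)

end Operators

section AbelMean

/-- The weighted average `r ^ p * ∫ θ in 0..π/2, h (r sin θ) cos θ ^ p`. For `p = 0` it is the
Abel transform `∫ t in 0..r, h t / √(r² - t²)` in the variable `t = r sin θ`; for larger `p` it is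
the unnormalised form of `r ^ p * sineAverage p h r`. -/
noncomputable def abelMean (p : ℕ) (h : ℝ → ℝ) (r : ℝ) : ℝ :=
  r ^ p * ∫ θ in (0 : ℝ)..(π / 2), h (r * sin θ) * cos θ ^ p

variable {h : ℝ → ℝ}

theorem abelMean_zero (h : ℝ → ℝ) (r : ℝ) :
    abelMean 0 h r = ∫ θ in (0 : ℝ)..(π / 2), h (r * sin θ) := by
  simp only [abelMean, pow_zero, mul_one, one_mul]

/-- Integrate the derivative of `h (r sin θ) * (sin θ * cos θ ^ (p + 1))` over `[0, π/2]`. -/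
theorem integral_deriv_mul_sin_mul_cos_pow (hh : ContDiff ℝ 1 h) (p : ℕ) (r : ℝ) :
    r * (∫ θ in (0 : ℝ)..(π / 2), deriv h (r * sin θ) * (sin θ * cos θ ^ (p + 2))) =
      (p + 1) * (∫ θ in (0 : ℝ)..(π / 2), h (r * sin θ) * cos θ ^ p) -
        (p + 2) * ∫ θ in (0 : ℝ)..(π / 2), h (r * sin θ) * cos θ ^ (p + 2) := by
  have := hh.continuous_deriv le_rfl
  have := hh.continuous
  rw [← intervalIntegral.integral_const_mul, ← intervalIntegral.integral_const_mul,
    ← intervalIntegral.integral_const_mul, ← intervalIntegral.integral_sub, ← sub_eq_zero,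
    ← intervalIntegral.integral_sub, intervalIntegral.integral_eq_sub_of_hasDerivAt
      (f := fun θ => h (r * sin θ) * (sin θ * cos θ ^ (p + 1)))]
  · simp
  · intro θ _
    have hcomp := (hh.differentiable one_ne_zero (r * sin θ)).hasDerivAt.comp θ
      ((hasDerivAt_sin θ).const_mul r)
    refine (hcomp.mul ((hasDerivAt_sin θ).mul ((hasDerivAt_cos θ).pow (p + 1)))).congr_deriv ?_
    simp only [comp_apply, Nat.add_sub_cancel, Pi.pow_apply, Pi.mul_apply]
    push_cast
    linear_combination (-(p + 1) * h (r * sin θ) * cos θ ^ p) * sin_sq_add_cos_sq θ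
  all_goals exact Continuous.intervalIntegrable (by fun_prop) _ _

theorem invMulDeriv_abelMean_add_two (hh : ContDiff ℝ 1 h) (p : ℕ) {r : ℝ} (hr : r ≠ 0) :
    invMulDeriv (abelMean (p + 2) h) r = (p + 1) * abelMean p h r := by
  have hderiv : deriv (abelMean (p + 2) h) r = _ := ((hasDerivAt_pow (p + 2) r).mul
    (hasDerivAt_integral_comp_mul_sin hh (w := fun θ => cos θ ^ (p + 2)) (by fun_prop)
      0 (π / 2) r)).deriv
  rw [invMulDeriv, inv_mul_eq_iff_eq_mul₀ hr, hderiv, abelMean]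
  push_cast
  linear_combination r ^ (p + 1) * integral_deriv_mul_sin_mul_cos_pow hh p r

theorem iterate_invMulDeriv_abelMean (hh : ContDiff ℝ 1 h) (m : ℕ) :
    EqOn (invMulDeriv^[m] (abelMean (2 * m) h)) (fun r => (2 * m - 1)‼ * abelMean 0 h r)
      (Ioi 0) := by
  induction m with
  | zero => intro r _; simp
  | succ m ih =>
    intro r hr
    have hstep : EqOn (invMulDeriv (abelMean (2 * (m + 1)) h))
        (fun s => (2 * m + 1) * abelMean (2 * m) h s) (Ioi 0) := fun s hs => by
      simpa [mul_add] using invMulDeriv_abelMean_add_two hh (2 * m) (ne_of_gt hs)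
    rw [iterate_succ_apply, iterate_invMulDeriv_eqOn isOpen_Ioi hstep m hr,
      iterate_invMulDeriv_const_mul]
    simp only [ih hr, show 2 * (m + 1) - 1 = 2 * m + 1 by lia, Nat.doubleFactorial_add_one]
    push_cast
    ring

/-- Write `h s = s * k s`; then `∂_r ∫ h (r sin θ) = ∫ r k' (r sin θ)` because the two integrands
differ by the derivative of `cos θ * k (r sin θ)`. -/
theorem invMulDeriv_abelMean_zero (hh : ContDiff ℝ ∞ h) (h0 : h =ᶠ[𝓝 0] 0) {r : ℝ}
    (hr : r ≠ 0) : invMulDeriv (abelMean 0 h) r = abelMean 0 (derivInvMul h) r := by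
  obtain ⟨k, hk, hk0, rfl, hhk⟩ : ∃ k : ℝ → ℝ, ContDiff ℝ ∞ k ∧ k 0 = 0 ∧ h = (fun s => s * k s) ∧
      derivInvMul h = deriv k := by
    refine ⟨fun s => s⁻¹ * h s, contDiff_inv_mul hh h0, by simp, funext fun s => ?_, rfl⟩
    rcases eq_or_ne s 0 with rfl | hs
    · simpa using h0.self_of_nhds
    · exact (mul_inv_cancel_left₀ hs _).symm
  have hkd : ∀ s, HasDerivAt k (deriv k s) s := fun s => (hk.differentiable (by simp) s).hasDerivAt
  have hdh : ∀ s, deriv (fun s => s * k s) s = k s + s * deriv k s := fun s => by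
    simpa using ((hasDerivAt_id' s).fun_mul (hkd s)).deriv
  have := hk.continuous
  have := hk.continuous_deriv (by simp)
  have hderiv : deriv (abelMean 0 fun s => s * k s) r =
      ∫ θ in (0 : ℝ)..(π / 2), deriv (fun s => s * k s) (r * sin θ) * (sin θ * 1) := by
    rw [← (hasDerivAt_integral_comp_mul_sin (hh.of_le (by simp)) continuous_const
      0 (π / 2) r).deriv]
    exact congrArg (deriv · r) (funext fun r => by simp [abelMean_zero])
  simp only [invMulDeriv, inv_mul_eq_iff_eq_mul₀ hr, hderiv, hhk, abelMean_zero, hdh]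
  rw [← intervalIntegral.integral_const_mul, eq_comm, ← sub_eq_zero,
    ← intervalIntegral.integral_sub,
    intervalIntegral.integral_eq_sub_of_hasDerivAt (f := fun θ => cos θ * k (r * sin θ))]
  · simp [hk0]
  · intro θ _
    refine ((hasDerivAt_cos θ).mul ((hkd (r * sin θ)).comp θ
      ((hasDerivAt_sin θ).const_mul r))).congr_deriv ?_
    simp only [comp_apply]
    linear_combination (r * deriv k (r * sin θ)) * sin_sq_add_cos_sq θ
  all_goals exact Continuous.intervalIntegrable (by fun_prop) _ _

theorem iterate_invMulDeriv_abelMean_zero (hh : ContDiff ℝ ∞ h) (h0 : h =ᶠ[𝓝 0] 0) (k : ℕ) :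
    EqOn (invMulDeriv^[k] (abelMean 0 h)) (abelMean 0 (derivInvMul^[k] h)) (Ioi 0) := by
  induction k generalizing h with
  | zero => exact fun _ _ => rfl
  | succ k ih =>
    exact (iterate_invMulDeriv_eqOn isOpen_Ioi
      (fun _ hs => invMulDeriv_abelMean_zero hh h0 (ne_of_gt hs)) k).trans
      (ih (contDiff_derivInvMul hh h0) (derivInvMul_eventuallyEq_zero h0))

theorem image_mul_sin_Ioo {r : ℝ} (hr : 0 < r) :
    (fun θ => r * sin θ) '' Ioo 0 (π / 2) = Ioo 0 r := by
  have hsin : sin '' Ioo 0 (π / 2) = Ioo 0 1 := by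
    ext t
    constructor
    · rintro ⟨θ, ⟨hθ₀, hθ₁⟩, rfl⟩
      refine ⟨sin_pos_of_pos_of_lt_pi hθ₀ (by linarith), ?_⟩
      simpa using sin_lt_sin_of_lt_of_le_pi_div_two (by linarith) le_rfl hθ₁
    · rintro ⟨ht₀, ht₁⟩
      exact ⟨arcsin t, ⟨arcsin_pos.2 ht₀, arcsin_lt_pi_div_two.2 ht₁⟩,
        sin_arcsin (by linarith) ht₁.le⟩
  rw [← image_image (r * ·) sin, hsin, image_mul_left_Ioo hr, mul_zero, mul_one]

theorem abs_mul_cos_mul_div_sqrt {r θ : ℝ} (hr : 0 < r) (hθ : θ ∈ Ioo 0 (π / 2)) (c : ℝ) :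
    |r * cos θ| * (c / √(r ^ 2 - (r * sin θ) ^ 2)) = c := by
  have hpos : 0 < r * cos θ := mul_pos hr (cos_pos_of_mem_Ioo ⟨by linarith [hθ.1, pi_pos], hθ.2⟩)
  have hsq : r ^ 2 - (r * sin θ) ^ 2 = (r * cos θ) ^ 2 := by
    linear_combination -(r ^ 2) * sin_sq_add_cos_sq θ
  rw [hsq, sqrt_sq hpos.le, abs_of_pos hpos, mul_div_cancel₀ _ hpos.ne']

theorem intervalIntegrable_div_sqrt_and_integral_eq_abelMean (hh : Continuous h) {r : ℝ}
    (hr : 0 < r) :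
    IntervalIntegrable (fun t => h t / √(r ^ 2 - t ^ 2)) volume 0 r ∧
      ∫ t in (0 : ℝ)..r, h t / √(r ^ 2 - t ^ 2) = abelMean 0 h r := by
  have hder : ∀ θ ∈ Ioo (0 : ℝ) (π / 2),
      HasDerivWithinAt (fun θ => r * sin θ) (r * cos θ) (Ioo 0 (π / 2)) θ := fun θ _ =>
    ((hasDerivAt_sin θ).const_mul r).hasDerivWithinAt
  have hinj : InjOn (fun θ => r * sin θ) (Ioo 0 (π / 2)) := fun a ha b hb hab =>
    injOn_sin ⟨by linarith [ha.1, pi_pos], ha.2.le⟩ ⟨by linarith [hb.1, pi_pos], hb.2.le⟩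
      (mul_left_cancel₀ hr.ne' hab)
  have hcongr : EqOn (fun θ => |r * cos θ| • (h (r * sin θ) / √(r ^ 2 - (r * sin θ) ^ 2)))
      (fun θ => h (r * sin θ)) (Ioo 0 (π / 2)) := fun θ hθ => abs_mul_cos_mul_div_sqrt hr hθ _
  have hint : IntegrableOn (fun θ => h (r * sin θ)) (Ioo 0 (π / 2)) :=
    (Continuous.integrableOn_Icc (by fun_prop)).mono_set Ioo_subset_Icc_self
  constructor
  · rw [intervalIntegrable_iff_integrableOn_Ioo_of_le hr.le, ← image_mul_sin_Ioo hr,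
      integrableOn_image_iff_integrableOn_abs_deriv_smul measurableSet_Ioo hder hinj]
    exact hint.congr_fun hcongr.symm measurableSet_Ioo
  · rw [intervalIntegral.integral_of_le hr.le, integral_Ioc_eq_integral_Ioo,
      ← image_mul_sin_Ioo hr,
      integral_image_eq_integral_abs_deriv_smul measurableSet_Ioo hder hinj,
      setIntegral_congr_fun measurableSet_Ioo hcongr, abelMean_zero,
      intervalIntegral.integral_of_le (by positivity), integral_Ioc_eq_integral_Ioo]

theorem integral_cos_pow_two_mul_mul_doubleFactorial (m : ℕ) :
    (∫ θ in (0 : ℝ)..(π / 2), cos θ ^ (2 * m)) * (2 * m)‼ = π / 2 * (2 * m - 1)‼ := by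
  induction m with
  | zero => simp
  | succ m ih =>
    have hrec := integral_cos_pow (a := 0) (b := π / 2) (n := 2 * m)
    simp only [show 2 * (m + 1) = 2 * m + 2 by ring, Nat.doubleFactorial_add_two, hrec,
      show 2 * m + 2 - 1 = 2 * m + 1 by lia, Nat.doubleFactorial_add_one, cos_pi_div_two, sin_zero,
      mul_zero, zero_pow (Nat.succ_ne_zero _), zero_mul, sub_zero, zero_div, zero_add]
    push_cast
    field_simp
    linear_combination 2 * ih

theorem integral_cos_pow_pos (p : ℕ) : 0 < ∫ θ in 0..(π / 2), cos θ ^ p :=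
  intervalIntegral.intervalIntegral_pos_of_pos_on
    (Continuous.intervalIntegrable (by fun_prop) _ _)
    (fun _ hθ => pow_pos (cos_pos_of_mem_Ioo ⟨by linarith [hθ.1, pi_pos], hθ.2⟩) p) (by positivity)

end AbelMean

section SineAverage

/-- The average of `h (r sin θ)` over `0 ≤ θ ≤ π/2` with weight `cos θ ^ p`. For `p = n - 2` and
`h = u x`, with `u` a wave on `ℝⁿ` with zero initial velocity, it is the spherical mean of the
initial value over the sphere of radius `r` around `x`. -/
noncomputable def sineAverage (p : ℕ) (h : ℝ → ℝ) (r : ℝ) : ℝ :=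
  (∫ θ in 0..(π / 2), cos θ ^ p)⁻¹ * ∫ θ in 0..(π / 2), h (r * sin θ) * cos θ ^ p

variable {h : ℝ → ℝ}

theorem contDiff_sineAverage (hh : ContDiff ℝ ∞ h) (p : ℕ) : ContDiff ℝ ∞ (sineAverage p h) :=
  contDiff_const.mul (contDiff_integral_comp_mul_sin hh (by fun_prop) 0 (π / 2))

theorem hasLineDerivAt_sineAverage {V : Type*} [NormedAddCommGroup V] [NormedSpace ℝ V]
    {w : V × ℝ → ℝ} (hw : ContDiff ℝ 1 w) (p : ℕ) (r : ℝ) (x v : V) :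
    HasLineDerivAt ℝ (fun y => sineAverage p (fun t => w (y, t)) r)
      (sineAverage p (fun t => fderiv ℝ w (x, t) (v, 0)) r) x v :=
  HasDerivAt.const_mul _
    (hasLineDerivAt_integral_comp_mul_sin hw (by fun_prop) 0 (π / 2) r x v)

theorem iterate_invMulDeriv_pow_mul_sineAverage (hh : ContDiff ℝ 1 h) (m : ℕ) :
    EqOn (invMulDeriv^[m] fun s => s ^ (2 * m) * sineAverage (2 * m) h s)
      (fun r => 2 * (2 * m + 2)‼ / (π * (2 * m + 2)) * abelMean 0 h r) (Ioi 0) := by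
  intro r hr
  have hnorm : (fun s => s ^ (2 * m) * sineAverage (2 * m) h s) =
      fun s => (∫ θ in 0..(π / 2), cos θ ^ (2 * m))⁻¹ * abelMean (2 * m) h s := by
    funext s
    rw [sineAverage, abelMean, mul_left_comm]
  have hconst : (∫ θ in 0..(π / 2), cos θ ^ (2 * m))⁻¹ * ((2 * m - 1)‼ : ℝ) =
      2 * (2 * m + 2)‼ / (π * (2 * m + 2)) := by
    rw [Nat.doubleFactorial_add_two, inv_mul_eq_div,
      div_eq_div_iff (integral_cos_pow_pos _).ne' (by positivity)]
    push_cast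
    linear_combination -2 * (2 * m + 2) * integral_cos_pow_two_mul_mul_doubleFactorial m
  rw [hnorm, iterate_invMulDeriv_const_mul]
  simp only [iterate_invMulDeriv_abelMean hh m hr, ← mul_assoc, hconst]

end SineAverage

section AbelIdentity

/-- The identity `(r⁻¹ ∂_r)^k (r^(n-2) N) = (2 γ_n / (π n)) ∫ t in 0..r, U t / √(r² - t²)` at the
radius `r`, where `γ_n = n‼`, together with the absolute convergence of the integral. -/
def SatisfiesAbelIdentity (n k : ℕ) (U N : ℝ → ℝ) (r : ℝ) : Prop :=
  IntervalIntegrable (fun t => U t / √(r ^ 2 - t ^ 2)) volume 0 r ∧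
    invMulDeriv^[k] (fun s => s ^ (n - 2) * N s) r =
      2 * (n‼ : ℝ) / (π * n) * ∫ t in (0 : ℝ)..r, U t / √(r ^ 2 - t ^ 2)

variable {h U N : ℝ → ℝ} {r : ℝ}

theorem intervalIntegrable_div_sqrt_and_integral_eq_of_eqOn (hh : Continuous h)
    (hU : EqOn U h (Ioi 0)) (hr : 0 < r) :
    IntervalIntegrable (fun t => U t / √(r ^ 2 - t ^ 2)) volume 0 r ∧
      ∫ t in (0 : ℝ)..r, U t / √(r ^ 2 - t ^ 2) = abelMean 0 h r := by
  obtain ⟨hint, heq⟩ := intervalIntegrable_div_sqrt_and_integral_eq_abelMean hh hr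
  have hcongr : EqOn (fun t => h t / √(r ^ 2 - t ^ 2)) (fun t => U t / √(r ^ 2 - t ^ 2))
      (Ioc 0 r) := fun t ht => by simp only [hU ht.1]
  refine ⟨hint.congr ?_, ?_⟩
  · rwa [uIoc_of_le hr.le]
  · rw [← heq, intervalIntegral.integral_of_le hr.le, intervalIntegral.integral_of_le hr.le,
      setIntegral_congr_fun measurableSet_Ioc hcongr]

theorem satisfiesAbelIdentity_of_iterate_eq {m k : ℕ} {H : ℝ → ℝ} (hH : Continuous H)
    (hU : EqOn U H (Ioi 0)) (hr : 0 < r)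
    (hN : invMulDeriv^[k] (fun s => s ^ (2 * m) * N s) r =
      2 * (2 * m + 2)‼ / (π * (2 * m + 2)) * abelMean 0 H r) :
    SatisfiesAbelIdentity (2 * m + 2) k U N r := by
  obtain ⟨hint, heq⟩ := intervalIntegrable_div_sqrt_and_integral_eq_of_eqOn hH hU hr
  refine ⟨hint, ?_⟩
  rw [heq, Nat.add_sub_cancel, hN]
  push_cast
  rfl

theorem iterate_invMulDeriv_pow_mul_of_eqOn (hh : ContDiff ℝ 1 h) (m : ℕ)
    (hN : EqOn N (sineAverage (2 * m) h) (Ioi 0)) :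
    EqOn (invMulDeriv^[m] fun s => s ^ (2 * m) * N s)
      (fun r => 2 * (2 * m + 2)‼ / (π * (2 * m + 2)) * abelMean 0 h r) (Ioi 0) :=
  (iterate_invMulDeriv_eqOn isOpen_Ioi (fun s hs => by rw [hN hs]) m).trans
    (iterate_invMulDeriv_pow_mul_sineAverage hh m)

theorem satisfiesAbelIdentity_of_eqOn (hh : ContDiff ℝ 1 h) (m : ℕ) (hU : EqOn U h (Ioi 0))
    (hN : EqOn N (sineAverage (2 * m) h) (Ioi 0)) (hr : 0 < r) :
    SatisfiesAbelIdentity (2 * m + 2) m U N r :=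
  satisfiesAbelIdentity_of_iterate_eq hh.continuous hU hr
    (iterate_invMulDeriv_pow_mul_of_eqOn hh m hN hr)

theorem satisfiesAbelIdentity_iterate_of_eqOn (hh : ContDiff ℝ ∞ h) (h0 : h =ᶠ[𝓝 0] 0) (m : ℕ)
    (hU : EqOn U h (Ioi 0)) (hN : EqOn N (sineAverage (2 * m) h) (Ioi 0)) (hr : 0 < r) :
    SatisfiesAbelIdentity (2 * m + 2) (2 * m) (derivInvMul^[m] U) N r := by
  refine satisfiesAbelIdentity_of_iterate_eq (contDiff_iterate_derivInvMul hh h0 m).continuous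
    (iterate_derivInvMul_eqOn isOpen_Ioi hU m) hr ?_
  have hhalf := iterate_invMulDeriv_pow_mul_of_eqOn (hh.of_le (by simp)) m hN
  rw [two_mul, iterate_add_apply, ← two_mul, iterate_invMulDeriv_eqOn isOpen_Ioi hhalf m hr,
    iterate_invMulDeriv_const_mul]
  simp only [iterate_invMulDeriv_abelMean_zero hh h0 m hr]

end AbelIdentity

section RadialMoment

/-- The radial Gaussian moment `∫ r in (0, ∞), r ^ k * exp (-r²)`. -/
noncomputable def radialMoment (k : ℕ) : ℝ := ∫ r in Ioi (0 : ℝ), r ^ k * exp (-r ^ 2)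

theorem radialMoment_eq_gamma (k : ℕ) : radialMoment k = 1 / 2 * Gamma ((k + 1) / 2) := by
  simpa [radialMoment] using integral_rpow_mul_exp_neg_rpow (p := 2) (q := k) two_pos
    (neg_one_lt_zero.trans_le k.cast_nonneg)

theorem radialMoment_pos (k : ℕ) : 0 < radialMoment k := by
  rw [radialMoment_eq_gamma]
  exact mul_pos one_half_pos (Gamma_pos_of_pos (by positivity))

theorem two_mul_radialMoment_add_two (k : ℕ) :
    2 * radialMoment (k + 2) = (k + 1) * radialMoment k := by
  rw [radialMoment_eq_gamma, radialMoment_eq_gamma]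
  push_cast
  rw [show ((k : ℝ) + 2 + 1) / 2 = (k + 1) / 2 + 1 by ring, Gamma_add_one (by positivity)]
  ring

theorem integrableOn_pow_mul_exp_neg_sq (k : ℕ) :
    IntegrableOn (fun r : ℝ => r ^ k * exp (-r ^ 2)) (Ioi 0) :=
  not_imp_comm.1 integral_undef (radialMoment_pos k).ne'

end RadialMoment

section SphereMoment

variable {V : Type*} [NormedAddCommGroup V] [InnerProductSpace ℝ V]

theorem hasFDerivAt_inner_pow (x w : V) (j : ℕ) :
    HasFDerivAt (fun x : V => ⟪x, w⟫_ℝ ^ j) ((j * ⟪x, w⟫_ℝ ^ (j - 1)) • innerSL ℝ w) x := by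
  simpa [real_inner_comm] using ((innerSL ℝ w).hasFDerivAt (x := x)).pow j

theorem hasFDerivAt_exp_neg_norm_sq (x : V) :
    HasFDerivAt (fun x : V => exp (-‖x‖ ^ 2))
      (exp (-‖x‖ ^ 2) • (-((2 : ℕ) • innerSL ℝ x) : V →L[ℝ] ℝ)) x :=
  (hasStrictFDerivAt_norm_sq x).hasFDerivAt.neg.exp

theorem fderiv_inner_pow_apply_self (x w : V) (j : ℕ) :
    fderiv ℝ (fun x : V => ⟪x, w⟫_ℝ ^ j) x w = j * ‖w‖ ^ 2 * ⟪x, w⟫_ℝ ^ (j - 1) := by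
  rw [(hasFDerivAt_inner_pow x w j).fderiv, ← real_inner_self_eq_norm_sq]
  exact mul_right_comm _ _ _

theorem fderiv_exp_neg_norm_sq_apply (x w : V) :
    fderiv ℝ (fun x : V => exp (-‖x‖ ^ 2)) x w = -2 * (⟪x, w⟫_ℝ * exp (-‖x‖ ^ 2)) := by
  rw [(hasFDerivAt_exp_neg_norm_sq x).fderiv]
  simp only [smul_apply, neg_apply, innerSL_apply_apply, smul_eq_mul, nsmul_eq_mul]
  push_cast
  ring

variable [FiniteDimensional ℝ V] [MeasurableSpace V] [BorelSpace V]

theorem integrable_inner_pow_mul_exp_neg_norm_sq [Nontrivial V] (w : V) (k : ℕ) :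
    Integrable (fun x : V => ⟪x, w⟫_ℝ ^ k * exp (-‖x‖ ^ 2)) := by
  have hnorm : Integrable (fun x : V => ‖w‖ ^ k * (‖x‖ ^ k * exp (-‖x‖ ^ 2))) := by
    refine Integrable.const_mul ?_ _
    rw [integrable_fun_norm_addHaar volume (f := fun r => r ^ k * exp (-r ^ 2))]
    simpa only [smul_eq_mul, ← mul_assoc, ← pow_add] using
      integrableOn_pow_mul_exp_neg_sq (Module.finrank ℝ V - 1 + k)
  refine hnorm.mono' (by fun_prop) (.of_forall fun x => ?_)
  rw [norm_mul, norm_pow, norm_of_nonneg (exp_nonneg _), ← mul_assoc, ← mul_pow, mul_comm ‖w‖]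
  gcongr
  exact norm_inner_le_norm x w

theorem two_mul_integral_inner_pow_succ_mul_exp_neg_norm_sq [Nontrivial V] (w : V) (j : ℕ) :
    2 * ∫ x : V, ⟪x, w⟫_ℝ ^ (j + 1) * exp (-‖x‖ ^ 2) =
      j * ‖w‖ ^ 2 * ∫ x : V, ⟪x, w⟫_ℝ ^ (j - 1) * exp (-‖x‖ ^ 2) := by
  have hpow : ∀ x : V, ⟪x, w⟫_ℝ ^ j * fderiv ℝ (fun x : V => exp (-‖x‖ ^ 2)) x w =
      -2 * (⟪x, w⟫_ℝ ^ (j + 1) * exp (-‖x‖ ^ 2)) := fun x => by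
    rw [fderiv_exp_neg_norm_sq_apply]
    ring
  have hexp : ∀ x : V, fderiv ℝ (fun x : V => ⟪x, w⟫_ℝ ^ j) x w * exp (-‖x‖ ^ 2) =
      j * ‖w‖ ^ 2 * (⟪x, w⟫_ℝ ^ (j - 1) * exp (-‖x‖ ^ 2)) := fun x => by
    rw [fderiv_inner_pow_apply_self, mul_assoc]
  have hint := integrable_inner_pow_mul_exp_neg_norm_sq w
  have key := integral_mul_fderiv_eq_neg_fderiv_mul_of_integrable (μ := (volume : Measure V))
    (f := fun x : V => ⟪x, w⟫_ℝ ^ j) (g := fun x : V => exp (-‖x‖ ^ 2)) (v := w)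
    (by simpa only [hexp] using (hint (j - 1)).const_mul _)
    (by simpa only [hpow] using (hint (j + 1)).const_mul _) (hint j)
    (fun x _ => (hasFDerivAt_inner_pow x w j).differentiableAt)
    (fun x _ => (hasFDerivAt_exp_neg_norm_sq x).differentiableAt)
  simp only [hpow, hexp, integral_const_mul] at key
  linarith

theorem integral_volumeIoiPow (n : ℕ) (g : ℝ → ℝ) :
    ∫ r : Ioi (0 : ℝ), g r ∂(Measure.volumeIoiPow n) = ∫ r in Ioi (0 : ℝ), r ^ n * g r := by
  simp only [Measure.volumeIoiPow, ENNReal.ofReal]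
  rw [integral_withDensity_eq_integral_smul (by fun_prop),
    integral_subtype_comap measurableSet_Ioi fun r : ℝ => Real.toNNReal (r ^ n) • g r]
  refine setIntegral_congr_fun measurableSet_Ioi fun r hr => ?_
  simp only [NNReal.smul_def, Real.coe_toNNReal _ (pow_nonneg (le_of_lt hr) n), smul_eq_mul]

theorem integral_mul_comp_norm_of_homogeneous {h : V → ℝ} {k : ℕ}
    (hh : ∀ (c : ℝ) (x : V), h (c • x) = c ^ k * h x) (g : ℝ → ℝ) [Nontrivial V] :
    ∫ x : V, h x * g ‖x‖ =
      (∫ y : Metric.sphere (0 : V) 1, h y ∂(volume : Measure V).toSphere) *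
        ∫ r in Ioi (0 : ℝ), r ^ (Module.finrank ℝ V - 1 + k) * g r := by
  calc ∫ x : V, h x * g ‖x‖
      = ∫ x : ({(0)}ᶜ : Set V), h x * g ‖x.1‖ ∂((volume : Measure V).comap (↑)) := by
        rw [integral_subtype_comap (measurableSet_singleton _).compl fun x : V => h x * g ‖x‖,
          restrict_compl_singleton]
    _ = ∫ p : Metric.sphere (0 : V) 1 × Ioi (0 : ℝ), h p.1 * ((p.2 : ℝ) ^ k * g p.2)
          ∂((volume : Measure V).toSphere.prod (.volumeIoiPow (Module.finrank ℝ V - 1))) := by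
        rw [← ((volume : Measure V).measurePreserving_homeomorphUnitSphereProd).integral_comp
          (Homeomorph.measurableEmbedding _)]
        refine integral_congr_ae (.of_forall fun x => ?_)
        have hx : ‖(x : V)‖ ≠ 0 := norm_ne_zero_iff.2 x.2
        simp only [homeomorphUnitSphereProd_apply_snd_coe, homeomorphUnitSphereProd_apply_fst_coe,
          hh]
        rw [mul_mul_mul_comm, ← mul_assoc, ← mul_pow, inv_mul_cancel₀ hx, one_pow, one_mul]
    _ = (∫ y : Metric.sphere (0 : V) 1, h y ∂(volume : Measure V).toSphere) *
          ∫ r : Ioi (0 : ℝ), (r : ℝ) ^ k * g r ∂(.volumeIoiPow (Module.finrank ℝ V - 1)) :=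
        integral_prod_mul (fun y : Metric.sphere (0 : V) 1 => h y)
          (fun r : Ioi (0 : ℝ) => (r : ℝ) ^ k * g r)
    _ = _ := by
        simp only [integral_volumeIoiPow _ fun r => r ^ k * g r, pow_add, mul_assoc]

/-- The moment `∫ ⟪y, w⟫ ^ k dσ(y)` of the surface measure `σ` of the unit sphere of `V`. -/
noncomputable def sphereMoment (w : V) (k : ℕ) : ℝ :=
  ∫ y : Metric.sphere (0 : V) 1, ⟪(y : V), w⟫_ℝ ^ k ∂(volume : Measure V).toSphere

theorem sphereMoment_zero (w : V) :
    sphereMoment w 0 = (volume : Measure V).toSphere.real univ := by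
  simp [sphereMoment]

theorem integral_inner_pow_mul_exp_neg_norm_sq [Nontrivial V] (w : V) (k : ℕ) :
    ∫ x : V, ⟪x, w⟫_ℝ ^ k * exp (-‖x‖ ^ 2) =
      sphereMoment w k * radialMoment (Module.finrank ℝ V - 1 + k) :=
  integral_mul_comp_norm_of_homogeneous (h := fun x => ⟪x, w⟫_ℝ ^ k)
    (fun c x => by rw [real_inner_smul_left, mul_pow]) fun r => exp (-r ^ 2)

theorem sphereMoment_one [Nontrivial V] (w : V) : sphereMoment w 1 = 0 := by
  have h := two_mul_integral_inner_pow_succ_mul_exp_neg_norm_sq w 0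
  rw [integral_inner_pow_mul_exp_neg_norm_sq] at h
  simpa [(radialMoment_pos _).ne'] using h

theorem sphereMoment_add_two [Nontrivial V] (w : V) (k : ℕ) :
    (Module.finrank ℝ V + k) * sphereMoment w (k + 2) = (k + 1) * ‖w‖ ^ 2 * sphereMoment w k := by
  have hgauss := two_mul_integral_inner_pow_succ_mul_exp_neg_norm_sq w (k + 1)
  have hradial := two_mul_radialMoment_add_two (Module.finrank ℝ V - 1 + k)
  have hpos : 0 < Module.finrank ℝ V := Module.finrank_pos
  rw [integral_inner_pow_mul_exp_neg_norm_sq, integral_inner_pow_mul_exp_neg_norm_sq] at hgauss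
  push_cast [Nat.cast_sub hpos] at hradial hgauss
  refine mul_right_cancel₀ (radialMoment_pos (Module.finrank ℝ V - 1 + k)).ne' ?_
  simp only [show k + 1 + 1 = k + 2 from rfl, ← add_assoc] at hgauss hradial
  linear_combination hgauss - sphereMoment w (k + 2) * hradial

/-- The moment `∫ sin θ ^ k * cos θ ^ p` over `[-π/2, π/2]`, which is up to normalisation the `k`-th
moment of a coordinate on the unit sphere of dimension `p + 1`. -/
noncomputable def sinMoment (p k : ℕ) : ℝ :=
  ∫ θ in (-(π / 2))..(π / 2), sin θ ^ k * cos θ ^ p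

theorem sinMoment_one (p : ℕ) : sinMoment p 1 = 0 := by
  have hodd := intervalIntegral.integral_comp_neg (a := -(π / 2)) (b := π / 2)
    fun θ => sin θ ^ 1 * cos θ ^ p
  simp only [sin_neg, cos_neg, pow_one, neg_mul, intervalIntegral.integral_neg, neg_neg] at hodd
  simp only [sinMoment, pow_one]
  linarith

/-- Integrate the derivative of `sin θ ^ (k + 1) * cos θ ^ (p + 1)`. -/
theorem sinMoment_add_two (p k : ℕ) :
    (p + 2 + k) * sinMoment p (k + 2) = (k + 1) * sinMoment p k := by
  rw [sinMoment, sinMoment, ← intervalIntegral.integral_const_mul,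
    ← intervalIntegral.integral_const_mul, eq_comm, ← sub_eq_zero,
    ← intervalIntegral.integral_sub, intervalIntegral.integral_eq_sub_of_hasDerivAt
      (f := fun θ => sin θ ^ (k + 1) * cos θ ^ (p + 1))]
  · simp
  · intro θ _
    refine (((hasDerivAt_sin θ).pow (k + 1)).mul
      ((hasDerivAt_cos θ).pow (p + 1))).congr_deriv ?_
    simp only [Nat.add_sub_cancel, Pi.pow_apply]
    push_cast
    linear_combination ((k + 1) * sin θ ^ k * cos θ ^ p) * sin_sq_add_cos_sq θ
  all_goals exact Continuous.intervalIntegrable (by fun_prop) _ _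

theorem sphereMoment_mul_sinMoment {p : ℕ} (hV : Module.finrank ℝ V = p + 2) (w : V) (k : ℕ) :
    sphereMoment w k * sinMoment p 0 = ‖w‖ ^ k * sinMoment p k * sphereMoment w 0 := by
  have : Nontrivial V := Module.nontrivial_of_finrank_pos (R := ℝ) (by lia)
  induction k using Nat.twoStepInduction with
  | zero => ring
  | one => simp [sphereMoment_one, sinMoment_one]
  | more k ih _ =>
    have hsphere := sphereMoment_add_two w k
    have hsin := sinMoment_add_two p k
    rw [hV] at hsphere
    push_cast at hsphere
    refine mul_left_cancel₀ (a := (p + 2 + k : ℝ)) (by positivity) ?_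
    linear_combination sinMoment p 0 * hsphere + (k + 1) * ‖w‖ ^ 2 * ih -
      ‖w‖ ^ (k + 2) * sphereMoment w 0 * hsin

end SphereMoment

section SphereFourier

theorem hasSum_integral_exp_mul {α : Type*} [MeasurableSpace α] {μ : Measure α} {g c : α → ℂ}
    {M : ℝ} (hg : AEStronglyMeasurable g μ) (hgM : ∀ a, ‖g a‖ ≤ M) (hc : Integrable c μ) :
    HasSum (fun k : ℕ => (k ! : ℂ)⁻¹ * ∫ a, g a ^ k * c a ∂μ)
      (∫ a, Complex.exp (g a) * c a ∂μ) := by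
  have hint : ∀ k : ℕ, Integrable (fun a => (k ! : ℂ)⁻¹ * (g a ^ k * c a)) μ := fun k =>
    (hc.bdd_mul (hg.pow k) (c := M ^ k) (.of_forall fun a => by
      simpa only [Pi.pow_apply, norm_pow] using
        pow_le_pow_left₀ (norm_nonneg _) (hgM a) k)).const_mul _
  have hbound : ∀ k : ℕ, ∫ a, ‖(k ! : ℂ)⁻¹ * (g a ^ k * c a)‖ ∂μ ≤
      M ^ k / k ! * ∫ a, ‖c a‖ ∂μ := fun k => by
    rw [← integral_const_mul]
    refine integral_mono (hint k).norm (hc.norm.const_mul _) fun a => ?_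
    rw [norm_mul, norm_mul, norm_inv, norm_pow, Complex.norm_natCast, ← mul_assoc, inv_mul_eq_div]
    gcongr
    exact hgM a
  have hexp : ∀ a, ∑' k : ℕ, (k ! : ℂ)⁻¹ * (g a ^ k * c a) = Complex.exp (g a) * c a := fun a => by
    rw [Complex.exp_eq_exp_ℂ, ← (NormedSpace.expSeries_div_hasSum_exp (g a)).tsum_eq,
      ← tsum_mul_right]
    simp only [div_eq_inv_mul, mul_assoc]
  simpa only [hexp, integral_const_mul] using hasSum_integral_of_summable_integral_norm hint
    (Summable.of_nonneg_of_le (fun _ => integral_nonneg fun _ => norm_nonneg _) hbound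
      ((summable_pow_div_factorial M).mul_right _))

theorem hasSum_integral_fourierChar_mul {α : Type*} [MeasurableSpace α] {μ : Measure α}
    {g c : α → ℝ} {M : ℝ} (hg : AEStronglyMeasurable g μ) (hgM : ∀ a, |g a| ≤ M)
    (hc : Integrable c μ) :
    HasSum (fun k : ℕ => ((2 * π * Complex.I) ^ k / k ! : ℂ) * ((∫ a, g a ^ k * c a ∂μ : ℝ) : ℂ))
      (∫ a, (𝐞 (g a) : ℂ) * c a ∂μ) := by
  have key := hasSum_integral_exp_mul (M := 2 * π * M) (c := fun a => (c a : ℂ))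
    ((Complex.continuous_ofReal.comp_aestronglyMeasurable hg).const_mul (2 * π * Complex.I))
    (fun a => ?_) hc.ofReal
  · convert key using 2 with k
    · rw [← integral_complex_ofReal, div_mul_eq_mul_div, mul_div_right_comm,
        div_eq_inv_mul, mul_assoc, ← integral_const_mul]
      simp only [mul_pow, mul_assoc, Complex.ofReal_mul, Complex.ofReal_pow]
    · funext a
      rw [Real.fourierChar_apply, Complex.ofReal_mul, mul_right_comm _ _ Complex.I]
      push_cast
      rfl
  · simpa [abs_of_pos, pi_pos, mul_assoc] using hgM a

variable {V : Type*} [NormedAddCommGroup V] [InnerProductSpace ℝ V] [FiniteDimensional ℝ V]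
  [MeasurableSpace V] [BorelSpace V]

/-- Both sides are power series in `w` with the moments `sphereMoment w k` and
`‖w‖ ^ k * sinMoment p k` as coefficients. -/
theorem integral_sphere_fourierChar_inner {p : ℕ} (hV : Module.finrank ℝ V = p + 2) (w : V) :
    (∫ y : Metric.sphere (0 : V) 1, (𝐞 ⟪(y : V), w⟫_ℝ : ℂ) ∂(volume : Measure V).toSphere) *
        sinMoment p 0 =
      (volume : Measure V).toSphere.real univ *
        ∫ θ in (-(π / 2))..(π / 2), (𝐞 (‖w‖ * sin θ) : ℂ) * (cos θ ^ p : ℝ) := by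
  have hsphere := hasSum_integral_fourierChar_mul (μ := (volume : Measure V).toSphere) (M := ‖w‖)
    (g := fun y : Metric.sphere (0 : V) 1 => ⟪(y : V), w⟫_ℝ) (c := fun _ => 1)
    (Continuous.aestronglyMeasurable (by fun_prop))
    (fun y => (abs_real_inner_le_norm _ _).trans (by simp)) (integrable_const 1)
  have hsin := hasSum_integral_fourierChar_mul (M := ‖w‖)
    (μ := volume.restrict (Ioc (-(π / 2)) (π / 2)))
    (g := fun θ => ‖w‖ * sin θ) (c := fun θ => cos θ ^ p) (by fun_prop)
    (fun θ => by
      rw [abs_mul, abs_norm]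
      exact mul_le_of_le_one_right (norm_nonneg _) (abs_sin_le_one θ))
    (Continuous.integrableOn_Ioc (by fun_prop))
  rw [intervalIntegral.integral_of_le (by linarith [pi_pos])]
  simp only [Complex.ofReal_one, mul_one] at hsphere
  refine (hsphere.mul_right (sinMoment p 0 : ℂ)).unique ?_
  convert hsin.mul_left ((volume : Measure V).toSphere.real univ : ℂ) using 1
  funext k
  have hmoment : ∫ θ in Ioc (-(π / 2)) (π / 2), (‖w‖ * sin θ) ^ k * cos θ ^ p =
      ‖w‖ ^ k * sinMoment p k := by
    rw [sinMoment, intervalIntegral.integral_of_le (by linarith [pi_pos]), ← integral_const_mul]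
    simp only [mul_pow, mul_assoc]
  have hcoeff := congrArg ((↑) : ℝ → ℂ) (sphereMoment_mul_sinMoment hV w k)
  rw [sphereMoment_zero, sphereMoment] at hcoeff
  rw [hmoment]
  push_cast at hcoeff ⊢
  linear_combination ((2 * π * Complex.I) ^ k / k !) * hcoeff

end SphereFourier

section SecondDerivatives

variable {V G : Type*} [NormedAddCommGroup V] [NormedAddCommGroup G] [NormedSpace ℝ G]

section NormedSpace

variable [NormedSpace ℝ V]

theorem hasDerivAt_comp_prodMk {F : V × ℝ → G} {x : V} {t : ℝ}
    (hF : DifferentiableAt ℝ F (x, t)) :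
    HasDerivAt (fun s => F (x, s)) (fderiv ℝ F (x, t) (0, 1)) t :=
  hF.hasFDerivAt.comp_hasDerivAt t ((hasDerivAt_const t x).prodMk (hasDerivAt_id t))

theorem hasFDerivAt_comp_prodMk_left {F : V × ℝ → G} {x : V} {t : ℝ}
    (hF : DifferentiableAt ℝ F (x, t)) :
    HasFDerivAt (fun y => F (y, t)) ((fderiv ℝ F (x, t)).comp (.inl ℝ V ℝ)) x :=
  hF.hasFDerivAt.comp x (hasFDerivAt_prodMk_left x t)

theorem eventually_differentiableAt {F : V → G} {x : V} (hF : ContDiffAt ℝ 2 F x) :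
    ∀ᶠ y in 𝓝 x, DifferentiableAt ℝ F y :=
  (hF.eventually (by simp)).mono fun _ hy => hy.differentiableAt (by simp)

theorem differentiableAt_fderiv {F : V → G} {x : V} (hF : ContDiffAt ℝ 2 F x) :
    DifferentiableAt ℝ (fderiv ℝ F) x :=
  (hF.fderiv_right (m := 1) (by norm_num)).differentiableAt (by simp)

theorem iteratedDeriv_two_comp_prodMk {F : V × ℝ → G} {x : V} {t : ℝ}
    (hF : ContDiffAt ℝ 2 F (x, t)) :
    iteratedDeriv 2 (fun s => F (x, s)) t = iteratedFDeriv ℝ 2 F (x, t) ![(0, 1), (0, 1)] := by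
  have hslice : Tendsto (fun s : ℝ => (x, s)) (𝓝 t) (𝓝 (x, t)) :=
    Continuous.tendsto (by fun_prop) t
  have hderiv : deriv (fun s => F (x, s)) =ᶠ[𝓝 t] fun s => fderiv ℝ F (x, s) (0, 1) :=
    (hslice.eventually (eventually_differentiableAt hF)).mono fun s hs =>
      (hasDerivAt_comp_prodMk hs).deriv
  rw [iteratedDeriv_succ, iteratedDeriv_one, hderiv.deriv_eq, iteratedFDeriv_two_apply]
  exact ((hasDerivAt_comp_prodMk (differentiableAt_fderiv hF)).clm_apply
    (hasDerivAt_const t ((0, 1) : V × ℝ))).deriv.trans (by simp)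

theorem iteratedFDeriv_two_comp_prodMk {F : V × ℝ → G} {x : V} {t : ℝ}
    (hF : ContDiffAt ℝ 2 F (x, t)) (e : V) :
    iteratedFDeriv ℝ 2 (fun y => F (y, t)) x ![e, e] =
      iteratedFDeriv ℝ 2 F (x, t) ![(e, 0), (e, 0)] := by
  have hslice : Tendsto (fun y : V => (y, t)) (𝓝 x) (𝓝 (x, t)) :=
    Continuous.tendsto (by fun_prop) x
  have hfderiv : fderiv ℝ (fun y => F (y, t)) =ᶠ[𝓝 x]
      fun y => (fderiv ℝ F (y, t)).comp (.inl ℝ V ℝ) :=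
    (hslice.eventually (eventually_differentiableAt hF)).mono fun y hy =>
      (hasFDerivAt_comp_prodMk_left hy).fderiv
  rw [iteratedFDeriv_two_apply, iteratedFDeriv_two_apply, hfderiv.fderiv_eq,
    ((hasFDerivAt_comp_prodMk_left (differentiableAt_fderiv hF)).clm_comp
      (hasFDerivAt_const (ContinuousLinearMap.inl ℝ V ℝ) x)).fderiv]
  simp

end NormedSpace

theorem laplacian_comp_prodMk [InnerProductSpace ℝ V] [FiniteDimensional ℝ V] {F : V × ℝ → G}
    {x : V} {t : ℝ} (hF : ContDiffAt ℝ 2 F (x, t)) {ι : Type*} [Fintype ι]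
    (b : OrthonormalBasis ι ℝ V) :
    Δ (fun y => F (y, t)) x = ∑ i, iteratedFDeriv ℝ 2 F (x, t) ![(b i, 0), (b i, 0)] := by
  rw [InnerProductSpace.laplacian_eq_iteratedFDeriv_orthonormalBasis _ b]
  simp only [iteratedFDeriv_two_comp_prodMk hF]

end SecondDerivatives

section HalfWave

open scoped SchwartzMap ComplexConjugate

variable {V : Type*} [NormedAddCommGroup V] [InnerProductSpace ℝ V]

/-- The bilinear form `((ξ, s), (x, t)) ↦ -(⟪ξ, x⟫ + s t)`, negated because
`VectorFourier.fourierIntegral` has the phase `-L`. -/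
noncomputable def coneForm (V : Type*) [NormedAddCommGroup V] [InnerProductSpace ℝ V] :
    (V × ℝ) →L[ℝ] (V × ℝ) →L[ℝ] ℝ :=
  let B : V →L[ℝ] V →L[ℝ] ℝ := innerSL ℝ;
  -(B.bilinearComp (.fst ℝ V ℝ) (.fst ℝ V ℝ) +
    (ContinuousLinearMap.mul ℝ ℝ).bilinearComp (.snd ℝ V ℝ) (.snd ℝ V ℝ))

theorem coneForm_apply (p q : V × ℝ) : coneForm V p q = -(⟪p.1, q.1⟫_ℝ + p.2 * q.2) :=
  rfl

variable [FiniteDimensional ℝ V] [MeasurableSpace V] [BorelSpace V]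

theorem measurableEmbedding_prodMk_norm {E : Type*} [NormedAddCommGroup E] [MeasurableSpace E]
    [BorelSpace E] : MeasurableEmbedding (fun ξ : E => (ξ, ‖ξ‖)) :=
  Topology.IsClosedEmbedding.measurableEmbedding
    (Function.LeftInverse.isClosedEmbedding (f := Prod.fst) (fun _ => rfl) continuous_fst
      (by fun_prop))

/-- The image of the volume of `V` on the forward light cone `{(ξ, ‖ξ‖)}` of frequencies. -/
noncomputable def coneMeasure (V : Type*) [NormedAddCommGroup V] [InnerProductSpace ℝ V]
    [FiniteDimensional ℝ V] [MeasurableSpace V] [BorelSpace V] : Measure (V × ℝ) :=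
  (volume : Measure V).map (fun ξ => (ξ, ‖ξ‖))

theorem ae_coneMeasure : ∀ᵐ p : V × ℝ ∂(coneMeasure V), p.2 = ‖p.1‖ :=
  measurableEmbedding_prodMk_norm.ae_map_iff.2 (.of_forall fun _ => rfl)

/-- The half-wave `(x, t) ↦ ∫ e^{2πi(⟪ξ, x⟫ + ‖ξ‖ t)} a(ξ) dξ` with amplitude `a`. It is encoded
as a Fourier integral over the light cone, which makes its derivatives Fourier integrals too. -/
noncomputable def halfWave (a : 𝓢(V, ℂ)) : V × ℝ → ℂ :=
  VectorFourier.fourierIntegral 𝐞 (coneMeasure V) (coneForm V).toLinearMap₁₂ (fun p => a p.1)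

theorem halfWave_apply (a : 𝓢(V, ℂ)) (x : V) (t : ℝ) :
    halfWave a (x, t) = ∫ ξ : V, (𝐞 (⟪ξ, x⟫_ℝ + ‖ξ‖ * t) : ℂ) * a ξ := by
  rw [halfWave, VectorFourier.fourierIntegral, coneMeasure,
    measurableEmbedding_prodMk_norm.integral_map]
  simp [coneForm_apply, Circle.smul_def]

theorem aestronglyMeasurable_amplitude (a : 𝓢(V, ℂ)) :
    AEStronglyMeasurable (fun p : V × ℝ => a p.1) (coneMeasure V) :=
  (a.continuous.comp continuous_fst).aestronglyMeasurable

theorem integrable_pow_mul_amplitude (a : 𝓢(V, ℂ)) (k : ℕ) :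
    Integrable (fun p : V × ℝ => ‖p‖ ^ k * ‖a p.1‖) (coneMeasure V) := by
  rw [coneMeasure, measurableEmbedding_prodMk_norm.integrable_map_iff]
  simpa [comp_def] using a.integrable_pow_mul volume k

theorem contDiff_halfWave (a : 𝓢(V, ℂ)) : ContDiff ℝ ∞ (halfWave a) :=
  VectorFourier.contDiff_fourierIntegral (N := ⊤) _ fun k _ => integrable_pow_mul_amplitude a k

theorem iteratedFDeriv_two_halfWave (a : 𝓢(V, ℂ)) {ι : Type*} [Fintype ι]
    (b : OrthonormalBasis ι ℝ V) (p : V × ℝ) :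
    iteratedFDeriv ℝ 2 (halfWave a) p ![(0, 1), (0, 1)] =
      ∑ i, iteratedFDeriv ℝ 2 (halfWave a) p ![(b i, 0), (b i, 0)] := by
  have hint := VectorFourier.integrable_fourierPowSMulRight (coneForm V)
    (integrable_pow_mul_amplitude a 2) (aestronglyMeasurable_amplitude a)
  have hint_apply : ∀ m : Fin 2 → V × ℝ,
      Integrable (fun q => 𝐞 (-(coneForm V).toLinearMap₁₂ q p) •
        VectorFourier.fourierPowSMulRight (coneForm V) (fun p => a p.1) q 2 m) (coneMeasure V) :=
    fun m => (VectorFourier.fourierIntegral_convergent_iff Real.continuous_fourierChar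
      (by exact (coneForm V).continuous₂) p).2
      ((ContinuousMultilinearMap.apply ℝ (fun _ : Fin 2 => V × ℝ) ℂ m).integrable_comp hint)
  rw [halfWave, VectorFourier.iteratedFDeriv_fourierIntegral (N := ⊤) (coneForm V)
    (fun k _ => integrable_pow_mul_amplitude a k) (aestronglyMeasurable_amplitude a) le_top]
  simp only [fourierIntegral_continuousMultilinearMap_apply' hint]
  simp only [VectorFourier.fourierIntegral]
  rw [← integral_finsetSum _ fun i _ => hint_apply _]
  refine integral_congr_ae (ae_coneMeasure.mono fun q hq => ?_)
  simp only [← Finset.smul_sum, VectorFourier.fourierPowSMulRight_apply, Fin.prod_univ_two,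
    coneForm_apply, ← Finset.sum_smul]
  congr 3
  simp [hq, ← b.sum_sq_inner_left q.1, ← sq]

theorem halfWave_neg {a : 𝓢(V, ℂ)} (ha : ∀ ξ, a (-ξ) = conj (a ξ)) (x : V) (t : ℝ) :
    halfWave a (x, -t) = conj (halfWave a (x, t)) := by
  rw [halfWave_apply, halfWave_apply, ← integral_conj, ← integral_neg_eq_self]
  congr 1
  funext ξ
  rw [map_mul, ha, ← Circle.coe_inv_eq_conj, ← AddChar.map_neg_eq_inv,
    inner_neg_left, norm_neg, mul_neg, neg_add]

theorem fourier_neg_eq_conj {f : V → ℂ} (hf : ∀ x, conj (f x) = f x) (ξ : V) :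
    𝓕 f (-ξ) = conj (𝓕 f ξ) := by
  rw [Real.fourier_eq, Real.fourier_eq, ← integral_conj]
  congr 1
  funext x
  rw [Circle.smul_def, Circle.smul_def, smul_eq_mul, smul_eq_mul, map_mul, hf,
    ← Circle.coe_inv_eq_conj, ← AddChar.map_neg_eq_inv, inner_neg_right]

theorem integral_integral_fourierChar_mul {α β : Type*} [MeasurableSpace α] [MeasurableSpace β]
    {μ : Measure α} {ν : Measure β} [SFinite μ] [SFinite ν] {g : α → β → ℝ} {h : β → ℝ}
    {c : α → ℂ} {A : β → ℂ} (hg : Measurable (uncurry g)) (hh : Measurable h)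
    (hc : Integrable c μ) (hA : Integrable A ν) :
    ∫ a, (∫ ξ, (𝐞 (h ξ + g a ξ) : ℂ) * A ξ ∂ν) * c a ∂μ =
      ∫ ξ, (𝐞 (h ξ) : ℂ) * A ξ * ∫ a, (𝐞 (g a ξ) : ℂ) * c a ∂μ ∂ν := by
  have hphase : Measurable fun q : α × β => (𝐞 (h q.2 + g q.1 q.2) : ℂ) :=
    (Continuous.measurable (f := fun s : ℝ => (𝐞 s : ℂ)) (by fun_prop)).comp
      ((hh.comp measurable_snd).add hg)
  have hint : Integrable (uncurry fun a ξ => (𝐞 (h ξ + g a ξ) : ℂ) * A ξ * c a) (μ.prod ν) :=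
    ((hc.mul_prod hA).bdd_mul (c := 1) hphase.aestronglyMeasurable
      (.of_forall fun q => (Circle.norm_coe _).le)).congr
      (.of_forall fun q => by simp only [uncurry]; ring)
  simp only [← integral_mul_const, ← integral_const_mul]
  rw [integral_integral_swap hint]
  simp only [AddChar.map_add_eq_mul, Circle.coe_mul, mul_left_comm, mul_comm]

theorem integral_sphere_mul_sinMoment {p : ℕ} (hV : Module.finrank ℝ V = p + 2) (a : 𝓢(V, ℂ))
    (x : V) {r : ℝ} (hr : 0 ≤ r) :
    (∫ y : Metric.sphere (0 : V) 1, halfWave a (x + r • (y : V), 0) ∂(volume : Measure V).toSphere)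
        * sinMoment p 0 =
      (volume : Measure V).toSphere.real univ *
        ∫ θ in (-(π / 2))..(π / 2), halfWave a (x, r * sin θ) * (cos θ ^ p : ℝ) := by
  have hsphere := integral_integral_fourierChar_mul (μ := (volume : Measure V).toSphere)
    (g := fun (y : Metric.sphere (0 : V) 1) ξ => ⟪(y : V), r • ξ⟫_ℝ) (h := fun ξ => ⟪ξ, x⟫_ℝ)
    (c := fun _ => 1) (Continuous.measurable (by fun_prop)) (by fun_prop) (integrable_const 1)
    (a.integrable (μ := volume))
  have harc := integral_integral_fourierChar_mul (μ := volume.restrict (Ioc (-(π / 2)) (π / 2)))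
    (g := fun θ ξ => ‖r • ξ‖ * sin θ) (h := fun ξ : V => ⟪ξ, x⟫_ℝ)
    (c := fun θ => ((cos θ ^ p : ℝ) : ℂ)) (Continuous.measurable (by fun_prop)) (by fun_prop)
    (Continuous.integrableOn_Ioc (by fun_prop)) (a.integrable (μ := volume))
  have hphase_sphere : ∀ ξ y : V, ⟪ξ, x + r • y⟫_ℝ + ‖ξ‖ * 0 = ⟪ξ, x⟫_ℝ + ⟪y, r • ξ⟫_ℝ :=
    fun ξ y => by
      rw [inner_add_right, inner_smul_right, inner_smul_right, real_inner_comm ξ y, mul_zero,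
        add_zero]
  have hphase_arc : ∀ (ξ : V) (s : ℝ), ‖ξ‖ * (r * s) = ‖r • ξ‖ * s := fun ξ s => by
    rw [norm_smul, norm_of_nonneg hr]
    ring
  simp only [mul_one] at hsphere
  simp only [halfWave_apply, hphase_sphere, hphase_arc,
    intervalIntegral.integral_of_le (by linarith [pi_pos] : -(π / 2) ≤ π / 2)]
  rw [hsphere, harc, ← integral_mul_const, ← integral_const_mul]
  congr 1
  funext ξ
  have hξ := integral_sphere_fourierChar_inner hV (r • ξ)
  rw [intervalIntegral.integral_of_le (by linarith [pi_pos])] at hξ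
  linear_combination ((𝐞 ⟪ξ, x⟫_ℝ : ℂ) * a ξ) * hξ

end HalfWave

section CosineWave

open scoped SchwartzMap ComplexConjugate

theorem integral_symm_eq_two_mul {g : ℝ → ℝ} (hg : Continuous g) (heven : ∀ θ, g (-θ) = g θ)
    (a : ℝ) : ∫ θ in (-a)..a, g θ = 2 * ∫ θ in 0..a, g θ := by
  have hfold : ∫ θ in (-a)..0, g θ = ∫ θ in 0..a, g θ := by
    simpa [heven] using (intervalIntegral.integral_comp_neg (a := 0) (b := a) g).symm
  rw [← intervalIntegral.integral_add_adjacent_intervals (hg.intervalIntegrable (-a) 0)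
    (hg.intervalIntegrable 0 a), hfold, two_mul]

variable {V : Type*} [NormedAddCommGroup V] [InnerProductSpace ℝ V] [FiniteDimensional ℝ V]
  [MeasurableSpace V] [BorelSpace V]

/-- The complex half-wave launched by a real Schwartz function; its real part solves the wave
equation with initial velocity `0`. -/
noncomputable def halfWaveOf (f : 𝓢(V, ℝ)) : V × ℝ → ℂ :=
  halfWave (𝓕 (f.postcompCLM Complex.ofRealCLM))

theorem contDiff_halfWaveOf (f : 𝓢(V, ℝ)) : ContDiff ℝ ∞ (halfWaveOf f) :=
  contDiff_halfWave _

theorem halfWaveOf_zero (f : 𝓢(V, ℝ)) (x : V) : halfWaveOf f (x, 0) = f x := by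
  set F := f.postcompCLM Complex.ofRealCLM with hF
  have hinv : (𝓕⁻ (𝓕 F)) x = F x := by rw [FourierTransform.fourierInv_fourier_eq]
  rw [SchwartzMap.fourierInv_coe, Real.fourierInv_eq] at hinv
  simpa [halfWaveOf, halfWave_apply, Circle.smul_def, hF] using hinv

theorem halfWaveOf_neg (f : 𝓢(V, ℝ)) (x : V) (t : ℝ) :
    halfWaveOf f (x, -t) = conj (halfWaveOf f (x, t)) :=
  halfWave_neg (fun ξ => by
    simpa only [SchwartzMap.fourier_coe] using fourier_neg_eq_conj (by simp) ξ) x t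

/-- The real wave `∫ e^{2πi⟪ξ, x⟫} cos(2π‖ξ‖t) 𝓕f(ξ) dξ` launched by the initial datum `f`,
encoded as the real part of the half-wave. -/
noncomputable def cosineWave (f : 𝓢(V, ℝ)) (p : V × ℝ) : ℝ :=
  (halfWaveOf f p).re

theorem contDiff_cosineWave (f : 𝓢(V, ℝ)) : ContDiff ℝ ∞ (cosineWave f) :=
  Complex.reCLM.contDiff.comp (contDiff_halfWaveOf f)

theorem cosineWave_zero (f : 𝓢(V, ℝ)) (x : V) : cosineWave f (x, 0) = f x := by
  rw [cosineWave, halfWaveOf_zero, Complex.ofReal_re]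

theorem cosineWave_neg (f : 𝓢(V, ℝ)) (x : V) (t : ℝ) :
    cosineWave f (x, -t) = cosineWave f (x, t) := by
  rw [cosineWave, halfWaveOf_neg, Complex.conj_re, cosineWave]

theorem iteratedDeriv_two_cosineWave (f : 𝓢(V, ℝ)) (x : V) (t : ℝ) :
    iteratedDeriv 2 (fun s => cosineWave f (x, s)) t = Δ (fun y => cosineWave f (y, t)) x := by
  have hW : ContDiff ℝ 2 (halfWaveOf f) := (contDiff_halfWaveOf f).of_le (by norm_cast)
  have hre : iteratedFDeriv ℝ 2 (cosineWave f) (x, t) =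
      Complex.reCLM.compContinuousMultilinearMap (iteratedFDeriv ℝ 2 (halfWaveOf f) (x, t)) :=
    Complex.reCLM.iteratedFDeriv_comp_left hW.contDiffAt le_rfl
  have hw : ContDiffAt ℝ 2 (cosineWave f) (x, t) :=
    (Complex.reCLM.contDiff.comp hW).contDiffAt
  rw [iteratedDeriv_two_comp_prodMk hw, laplacian_comp_prodMk hw (stdOrthonormalBasis ℝ V), hre]
  simp only [ContinuousLinearMap.compContinuousMultilinearMap_coe, comp_apply]
  rw [halfWaveOf, iteratedFDeriv_two_halfWave _ (stdOrthonormalBasis ℝ V), map_sum]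

theorem integral_sphere_mul_integral_cos_pow {p : ℕ} (hV : Module.finrank ℝ V = p + 2)
    (f : 𝓢(V, ℝ)) (x : V) {r : ℝ} (hr : 0 ≤ r) :
    (∫ y : Metric.sphere (0 : V) 1, f (x + r • (y : V)) ∂(volume : Measure V).toSphere) *
        (∫ θ in 0..(π / 2), cos θ ^ p) =
      (volume : Measure V).toSphere.real univ *
        ∫ θ in 0..(π / 2), cosineWave f (x, r * sin θ) * cos θ ^ p := by
  have hcont : Continuous fun θ : ℝ => halfWaveOf f (x, r * sin θ) * (cos θ ^ p : ℝ) := by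
    have := (contDiff_halfWaveOf f).continuous
    fun_prop
  have hcont_re : Continuous fun θ : ℝ => cosineWave f (x, r * sin θ) * cos θ ^ p := by
    have := (contDiff_cosineWave f).continuous
    fun_prop
  have hre : (∫ θ in (-(π / 2))..(π / 2), halfWaveOf f (x, r * sin θ) * (cos θ ^ p : ℝ)).re =
      2 * ∫ θ in 0..(π / 2), cosineWave f (x, r * sin θ) * cos θ ^ p := by
    rw [← integral_symm_eq_two_mul hcont_re fun θ => by
      rw [sin_neg, cos_neg, mul_neg, cosineWave_neg]]
    simpa only [Complex.reCLM_apply, Complex.re_mul_ofReal, cosineWave] using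
      (Complex.reCLM.intervalIntegral_comp_comm (hcont.intervalIntegrable _ _)).symm
  have hsin : sinMoment p 0 = 2 * ∫ θ in 0..(π / 2), cos θ ^ p := by
    rw [← integral_symm_eq_two_mul (by fun_prop) fun θ => by rw [cos_neg]]
    simp only [sinMoment, pow_zero, one_mul]
  have hsphere := congrArg Complex.re
    (integral_sphere_mul_sinMoment hV (𝓕 (f.postcompCLM Complex.ofRealCLM)) x hr)
  rw [← halfWaveOf] at hsphere
  simp only [halfWaveOf_zero, integral_complex_ofReal, Complex.re_ofReal_mul,
    Complex.ofReal_re, hre, hsin] at hsphere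
  linear_combination (1 / 2) * hsphere

end CosineWave

section LaunchedWave

open scoped SchwartzMap

variable {n : ℕ} (f : 𝓢(EuclideanSpace ℝ (Fin n), ℝ))

theorem isWaveSolution_cosineWave :
    IsWaveSolution f (fun _ => 0) fun x t => cosineWave f (x, t) where
  contDiffOn_two := ((contDiff_cosineWave f).of_le (by norm_cast)).contDiffOn
  contDiffOn_one := ((contDiff_cosineWave f).of_le (by norm_cast)).contDiffOn
  wave_eq x t _ := sub_eq_zero.2 (iteratedDeriv_two_cosineWave f x t)
  initial_value := cosineWave_zero f
  initial_velocity x := by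
    have hdiff : DifferentiableAt ℝ (fun t => cosineWave f (x, t)) 0 :=
      ((contDiff_cosineWave f).comp (contDiff_prodMk_right x)).differentiable (by simp) 0
    have heven := deriv_comp_neg (fun t => cosineWave f (x, t)) 0
    simp only [cosineWave_neg, neg_zero] at heven
    rw [hdiff.derivWithin (uniqueDiffWithinAt_Ici 0)]
    linarith

theorem sphericalMean_eq_sineAverage_cosineWave {p : ℕ} (hn : n = p + 2)
    (x : EuclideanSpace ℝ (Fin n)) {r : ℝ} (hr : 0 ≤ r) :
    sphericalMean f x r = sineAverage p (fun t => cosineWave f (x, t)) r := by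
  have hsphere := integral_sphere_mul_integral_cos_pow (by simpa using hn) f x hr
  rw [Measure.toSphere_real_apply_univ, finrank_euclideanSpace, Fintype.card_fin] at hsphere
  have hball : 0 < volume.real (Metric.ball (0 : EuclideanSpace ℝ (Fin n)) 1) :=
    ENNReal.toReal_pos (Metric.measure_ball_pos volume 0 one_pos).ne' measure_ball_lt_top.ne
  have hn_pos : (0 : ℝ) < n := by
    rw [hn]
    positivity
  rw [sphericalMean, sineAverage, inv_mul_eq_div, inv_mul_eq_div,
    div_eq_div_iff (mul_pos hn_pos hball).ne' (integral_cos_pow_pos p).ne', hsphere, mul_comm]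

end LaunchedWave

section CompactSupport

theorem continuous_comp_prodMk_left {X Y G : Type*} [TopologicalSpace X] [TopologicalSpace Y]
    [TopologicalSpace G] {H : X × Y → G} {U : Set Y} (hH : ContinuousOn H (univ ×ˢ U)) {t : Y}
    (ht : t ∈ U) : Continuous fun x => H (x, t) :=
  continuousOn_univ.1 <| hH.comp (f := fun x => (x, t)) (by fun_prop) fun x _ => ⟨mem_univ x, ht⟩

variable {V : Type*} [NormedAddCommGroup V] [MeasurableSpace V] [BorelSpace V] {μ : Measure V}

theorem hasDerivAt_integral_of_compact_support [IsFiniteMeasureOnCompacts μ] {U : Set ℝ}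
    (hU : IsOpen U) {K : Set V} (hK : IsCompact K)
    {G G' : V × ℝ → ℝ} (hG : ContinuousOn G (univ ×ˢ U)) (hG' : ContinuousOn G' (univ ×ˢ U))
    (hderiv : ∀ y, ∀ s ∈ U, HasDerivAt (fun s => G (y, s)) (G' (y, s)) s)
    (hzero : ∀ y ∉ K, ∀ s ∈ U, G (y, s) = 0) {t : ℝ} (ht : t ∈ U) :
    HasDerivAt (fun s => ∫ y, G (y, s) ∂μ) (∫ y, G' (y, t) ∂μ) t := by
  have hzero' : ∀ y ∉ K, ∀ s ∈ U, G' (y, s) = 0 := fun y hy s hs =>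
    (hderiv y s hs).unique <| (hasDerivAt_const s (0 : ℝ)).congr_of_eventuallyEq <|
      (eventually_of_mem (hU.mem_nhds hs)) fun r hr => hzero y hy r hr
  obtain ⟨ε, hε, hεU⟩ := Metric.nhds_basis_closedBall.mem_iff.1 (hU.mem_nhds ht)
  obtain ⟨C, hC⟩ := (hK.prod (isCompact_closedBall t ε)).exists_bound_of_continuousOn
    (hG'.mono (prod_mono (subset_univ K) hεU))
  refine (hasDerivAt_integral_of_dominated_loc_of_deriv_le (F' := fun s y => G' (y, s))
    (bound := K.indicator fun _ => C) (Metric.closedBall_mem_nhds t hε) ?_ ?_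
    (continuous_comp_prodMk_left hG' ht).aestronglyMeasurable (.of_forall fun y s hs => ?_) ?_
    (.of_forall fun y s hs => hderiv y s (hεU hs))).2
  · filter_upwards [hU.mem_nhds ht] with s hs
    exact (continuous_comp_prodMk_left hG hs).aestronglyMeasurable
  · exact (continuous_comp_prodMk_left hG ht).integrable_of_hasCompactSupport
      (.intro hK fun y hy => hzero y hy t ht)
  · by_cases hy : y ∈ K
    · simpa [hy] using hC (y, s) ⟨hy, hs⟩
    · simp [hy, hzero' y hy s (hεU hs)]
  · exact (integrable_indicator_iff hK.measurableSet).2 (integrableOn_const hK.measure_ne_top)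

theorem integral_eq_zero_of_hasLineDerivAt [NormedSpace ℝ V] [FiniteDimensional ℝ V]
    [μ.IsAddHaarMeasure] {g g' : V → ℝ} {v : V} (hg : Integrable g μ) (hg' : Integrable g' μ)
    (hderiv : ∀ y, HasLineDerivAt ℝ g (g' y) y v) : ∫ y, g' y ∂μ = 0 := by
  simpa using integral_bilinear_hasLineDerivAt_right_eq_neg_left_of_integrable (μ := μ)
    (B := ContinuousLinearMap.mul ℝ ℝ) (f := fun _ => 1) (f' := fun _ => 0) (g := g) (v := v)
    (by simp) (by simpa using hg') (by simpa using hg)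
    (fun _ _ => hasDerivAt_const (0 : ℝ) (1 : ℝ)) (fun y _ => hderiv y)

end CompactSupport

section Cone

variable {V : Type*} [NormedAddCommGroup V]

/-- The function `max ((R - t)² - ‖y - x₀‖²) 0`, positive exactly inside the double light cone
with apex `(x₀, R)`. Its square is a `C¹` weight for the energy. -/
noncomputable def conePart (x₀ : V) (R : ℝ) (p : V × ℝ) : ℝ :=
  max ((R - p.2) ^ 2 - ‖p.1 - x₀‖ ^ 2) 0

@[fun_prop]
theorem continuous_conePart (x₀ : V) (R : ℝ) : Continuous (conePart x₀ R) := by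
  unfold conePart
  fun_prop

theorem conePart_nonneg (x₀ : V) (R : ℝ) (p : V × ℝ) : 0 ≤ conePart x₀ R p :=
  le_max_right _ _

theorem conePart_pos_iff {x₀ y : V} {R t : ℝ} (htR : t ≤ R) :
    0 < conePart x₀ R (y, t) ↔ ‖y - x₀‖ < R - t := by
  rw [conePart, lt_max_iff, or_iff_left (lt_irrefl _), sub_pos,
    sq_lt_sq₀ (norm_nonneg _) (sub_nonneg.2 htR)]

theorem conePart_eq_zero {x₀ y : V} {R t : ℝ} (ht : t ∈ Icc 0 R) (hy : y ∉ Metric.ball x₀ R) :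
    conePart x₀ R (y, t) = 0 := by
  refine le_antisymm (not_lt.1 fun hpos => hy ?_) (conePart_nonneg _ _ _)
  rw [mem_ball_iff_norm]
  linarith [(conePart_pos_iff ht.2).1 hpos, ht.1]

theorem integrable_of_conePart_eq_zero [ProperSpace V] [MeasurableSpace V] [BorelSpace V]
    {μ : Measure V} [IsFiniteMeasureOnCompacts μ] {x₀ : V} {R t : ℝ} (ht : t ∈ Icc 0 R)
    {g : V → ℝ} (hg : Continuous g) (hzero : ∀ y, conePart x₀ R (y, t) = 0 → g y = 0) :
    Integrable g μ :=
  hg.integrable_of_hasCompactSupport <| .intro (isCompact_closedBall x₀ R) fun y hy =>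
    hzero y <| conePart_eq_zero ht fun hmem => hy (Metric.ball_subset_closedBall hmem)

theorem hasDerivAt_max_zero_sq (s : ℝ) :
    HasDerivAt (fun s : ℝ => max s 0 ^ 2) (2 * max s 0) s := by
  refine hasDerivAt_of_hasDerivAt_of_ne' (x := 0) (g := fun s => 2 * max s 0) (fun y hy => ?_)
    (Continuous.continuousAt (by fun_prop)) (Continuous.continuousAt (by fun_prop)) s
  rcases hy.lt_or_gt with hy | hy
  · have hlocal : (fun s : ℝ => max s 0 ^ 2) =ᶠ[𝓝 y] fun _ => 0 := by
      filter_upwards [Iio_mem_nhds hy] with s hs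
      simp [max_eq_right (mem_Iio.1 hs).le]
    simpa [max_eq_right hy.le] using (hasDerivAt_const y (0 : ℝ)).congr_of_eventuallyEq hlocal
  · have hlocal : (fun s : ℝ => max s 0 ^ 2) =ᶠ[𝓝 y] fun s => s ^ 2 := by
      filter_upwards [Ioi_mem_nhds hy] with s hs
      rw [max_eq_left (mem_Ioi.1 hs).le]
    simpa [max_eq_left hy.le] using (hasDerivAt_pow 2 y).congr_of_eventuallyEq hlocal

theorem hasDerivAt_conePart_sq_time (x₀ : V) (R : ℝ) (y : V) (t : ℝ) :
    HasDerivAt (fun s => conePart x₀ R (y, s) ^ 2) (-4 * conePart x₀ R (y, t) * (R - t)) t := by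
  have hinner : HasDerivAt (fun s : ℝ => (R - s) ^ 2 - ‖y - x₀‖ ^ 2) (2 * (R - t) * (-1)) t := by
    simpa using (((hasDerivAt_id t).const_sub R).pow 2).sub_const (‖y - x₀‖ ^ 2)
  refine ((hasDerivAt_max_zero_sq _).comp t hinner).congr_deriv ?_
  rw [conePart]
  ring

theorem hasLineDerivAt_conePart_sq [InnerProductSpace ℝ V] (x₀ : V) (R : ℝ) (y e : V) (t : ℝ) :
    HasLineDerivAt ℝ (fun y => conePart x₀ R (y, t) ^ 2)
      (-4 * conePart x₀ R (y, t) * ⟪y - x₀, e⟫_ℝ) y e := by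
  have hline : HasDerivAt (fun s : ℝ => y + s • e - x₀) e 0 := by
    simpa using (((hasDerivAt_id (0 : ℝ)).smul_const e).const_add y).sub_const x₀
  have hinner : HasDerivAt (fun s : ℝ => (R - t) ^ 2 - ‖y + s • e - x₀‖ ^ 2)
      (-(2 * ⟪y - x₀, e⟫_ℝ)) 0 := by
    simpa using hline.norm_sq.const_sub ((R - t) ^ 2)
  refine ((hasDerivAt_max_zero_sq _).comp 0 hinner).congr_deriv ?_
  rw [conePart, zero_smul, add_zero]
  ring

end Cone

section EnergyDensity

variable {V ι : Type*} [NormedAddCommGroup V] [InnerProductSpace ℝ V] [Fintype ι]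

/-- The energy density `(∂ₜF² + |∇F|²) / 2` as a function of the differential `A` of `F`. -/
noncomputable def energyDensity (b : OrthonormalBasis ι ℝ V) (A : V × ℝ →L[ℝ] ℝ) : ℝ :=
  (A (0, 1) ^ 2 + ∑ i, A (b i, 0) ^ 2) / 2

@[fun_prop]
theorem continuous_energyDensity (b : OrthonormalBasis ι ℝ V) : Continuous (energyDensity b) := by
  unfold energyDensity
  fun_prop

theorem energyDensity_nonneg (b : OrthonormalBasis ι ℝ V) (A : V × ℝ →L[ℝ] ℝ) :
    0 ≤ energyDensity b A := by
  unfold energyDensity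
  positivity

theorem apply_time_eq_zero_of_energyDensity_eq_zero {b : OrthonormalBasis ι ℝ V}
    {A : V × ℝ →L[ℝ] ℝ} (hA : energyDensity b A = 0) : A (0, 1) = 0 := by
  have hspace : 0 ≤ ∑ i, A (b i, 0) ^ 2 := by positivity
  rw [energyDensity] at hA
  exact (pow_eq_zero_iff two_ne_zero).1 (le_antisymm (by linarith) (sq_nonneg _))

theorem flux_le_energyDensity (b : OrthonormalBasis ι ℝ V) (A : V × ℝ →L[ℝ] ℝ) {z : V} {c : ℝ}
    (hc : 0 < c) (hz : ‖z‖ ≤ c) :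
    A (0, 1) * ∑ i, ⟪z, b i⟫_ℝ * A (b i, 0) ≤ c * energyDensity b A := by
  have hcs := Finset.sum_mul_sq_le_sq_mul_sq Finset.univ (fun i => ⟪z, b i⟫_ℝ)
    (fun i => A (b i, 0))
  rw [b.sum_sq_inner_left] at hcs
  have hsq : (∑ i, ⟪z, b i⟫_ℝ * A (b i, 0)) ^ 2 ≤ c ^ 2 * ∑ i, A (b i, 0) ^ 2 :=
    hcs.trans (by gcongr)
  unfold energyDensity
  refine le_of_mul_le_mul_left ?_ hc
  linarith [sq_nonneg (c * A (0, 1) - ∑ i, ⟪z, b i⟫_ℝ * A (b i, 0))]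

end EnergyDensity

section EnergyIdentity

variable {V ι : Type*} [NormedAddCommGroup V] [InnerProductSpace ℝ V] [Fintype ι] {F : V × ℝ → ℝ}

theorem hasLineDerivAt_fderiv_apply {y : V} {t : ℝ} (hF : ContDiffAt ℝ 2 F (y, t)) (e : V)
    (p : V × ℝ) :
    HasLineDerivAt ℝ (fun y => fderiv ℝ F (y, t) p)
      (fderiv ℝ (fderiv ℝ F) (y, t) (e, 0) p) y e := by
  simpa using ((hasFDerivAt_comp_prodMk_left (differentiableAt_fderiv hF)).clm_apply
    (hasFDerivAt_const p y)).hasLineDerivAt e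

theorem hasDerivAt_fderiv_apply_time {y : V} {t : ℝ} (hF : ContDiffAt ℝ 2 F (y, t)) (p : V × ℝ) :
    HasDerivAt (fun s => fderiv ℝ F (y, s) p) (fderiv ℝ (fderiv ℝ F) (y, t) (0, 1) p) t := by
  simpa using (hasDerivAt_comp_prodMk (differentiableAt_fderiv hF)).clm_apply
    (hasDerivAt_const t p)

/-- The time derivative of the energy density of `F` weighted by `conePart x₀ R ^ 2`. -/
noncomputable def coneEnergyRate (b : OrthonormalBasis ι ℝ V) (F : V × ℝ → ℝ) (x₀ : V) (R : ℝ)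
    (p : V × ℝ) : ℝ :=
  -4 * conePart x₀ R p * (R - p.2) * energyDensity b (fderiv ℝ F p) +
    conePart x₀ R p ^ 2 * (fderiv ℝ F p (0, 1) * fderiv ℝ (fderiv ℝ F) p (0, 1) (0, 1) +
      ∑ i, fderiv ℝ F p (b i, 0) * fderiv ℝ (fderiv ℝ F) p (0, 1) (b i, 0))

theorem hasDerivAt_conePart_sq_mul_energyDensity (b : OrthonormalBasis ι ℝ V) {y : V} {t : ℝ}
    (hF : ContDiffAt ℝ 2 F (y, t)) (x₀ : V) (R : ℝ) :
    HasDerivAt (fun s => conePart x₀ R (y, s) ^ 2 * energyDensity b (fderiv ℝ F (y, s)))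
      (coneEnergyRate b F x₀ R (y, t)) t := by
  have hdensity : HasDerivAt (fun s => energyDensity b (fderiv ℝ F (y, s))) _ t :=
    (((hasDerivAt_fderiv_apply_time hF (0, 1)).pow 2).add
      (HasDerivAt.fun_sum (u := Finset.univ) fun i _ =>
        (hasDerivAt_fderiv_apply_time hF (b i, 0)).pow 2)).div_const 2
  refine ((hasDerivAt_conePart_sq_time x₀ R y t).mul hdensity).congr_deriv ?_
  simp only [coneEnergyRate, Nat.cast_ofNat, mul_assoc, ← Finset.mul_sum, Nat.add_one_sub_one,
    pow_one]
  ring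

/-- The derivative in the direction `e` of the component `∂ₜF ∂ₑF` of the energy flux of `F`,
weighted by `conePart x₀ R ^ 2`. -/
noncomputable def coneFluxDeriv (F : V × ℝ → ℝ) (x₀ : V) (R : ℝ) (p : V × ℝ) (e : V) : ℝ :=
  -4 * conePart x₀ R p * fderiv ℝ F p (0, 1) * (⟪p.1 - x₀, e⟫_ℝ * fderiv ℝ F p (e, 0)) +
    conePart x₀ R p ^ 2 * (fderiv ℝ F p (e, 0) * fderiv ℝ (fderiv ℝ F) p (e, 0) (0, 1)) +
    conePart x₀ R p ^ 2 * fderiv ℝ F p (0, 1) * fderiv ℝ (fderiv ℝ F) p (e, 0) (e, 0)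

theorem hasLineDerivAt_conePart_sq_mul_flux {y : V} {t : ℝ} (hF : ContDiffAt ℝ 2 F (y, t))
    (x₀ : V) (R : ℝ) (e : V) :
    HasLineDerivAt ℝ
      (fun y => conePart x₀ R (y, t) ^ 2 * (fderiv ℝ F (y, t) (0, 1) * fderiv ℝ F (y, t) (e, 0)))
      (coneFluxDeriv F x₀ R (y, t) e) y e := by
  refine ((hasLineDerivAt_conePart_sq x₀ R y e t).mul
    ((hasLineDerivAt_fderiv_apply hF e (0, 1)).mul
      (hasLineDerivAt_fderiv_apply hF e (e, 0)))).congr_deriv ?_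
  simp only [zero_smul, add_zero, Pi.mul_apply, coneFluxDeriv]
  ring

theorem coneEnergyRate_le_sum_coneFluxDeriv {b : OrthonormalBasis ι ℝ V} {y : V} {t : ℝ}
    (hF : ContDiffAt ℝ 2 F (y, t))
    (hwave : fderiv ℝ (fderiv ℝ F) (y, t) (0, 1) (0, 1) =
      ∑ i, fderiv ℝ (fderiv ℝ F) (y, t) (b i, 0) (b i, 0)) (x₀ : V) {R : ℝ} (htR : t < R) :
    coneEnergyRate b F x₀ R (y, t) ≤ ∑ i, coneFluxDeriv F x₀ R (y, t) (b i) := by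
  have hsymm (p : V × ℝ) : fderiv ℝ (fderiv ℝ F) (y, t) (0, 1) p =
      fderiv ℝ (fderiv ℝ F) (y, t) p (0, 1) := (hF.isSymmSndFDerivAt (by simp)) (0, 1) p
  have hflux : conePart x₀ R (y, t) *
      (fderiv ℝ F (y, t) (0, 1) * ∑ i, ⟪y - x₀, b i⟫_ℝ * fderiv ℝ F (y, t) (b i, 0)) ≤
        conePart x₀ R (y, t) * ((R - t) * energyDensity b (fderiv ℝ F (y, t))) := by
    rcases (conePart_nonneg x₀ R (y, t)).eq_or_lt with hzero | hpos
    · simp [← hzero]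
    · exact mul_le_mul_of_nonneg_left (flux_le_energyDensity b _ (sub_pos.2 htR)
        ((conePart_pos_iff htR.le).1 hpos).le) hpos.le
  simp only [coneEnergyRate, coneFluxDeriv, Finset.sum_add_distrib, ← Finset.mul_sum, ← hwave,
    ← hsymm]
  linarith

end EnergyIdentity

section ClassicalWave

variable {V : Type*} [NormedAddCommGroup V] [InnerProductSpace ℝ V] [FiniteDimensional ℝ V]

/-- A classical solution of the wave equation on `V × [0, ∞)`, as a function of the pair `(y, t)`;
no initial data are prescribed. -/
structure IsClassicalWave (F : V × ℝ → ℝ) : Prop where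
  contDiffOn_two : ContDiffOn ℝ 2 F (univ ×ˢ Ioi (0 : ℝ))
  contDiffOn_one : ContDiffOn ℝ 1 F (univ ×ˢ Ici (0 : ℝ))
  wave_eq : ∀ y t, 0 < t → iteratedDeriv 2 (fun s => F (y, s)) t = Δ (fun z => F (z, t)) y

namespace IsClassicalWave

variable {ι : Type*} [Fintype ι] {F : V × ℝ → ℝ} (hF : IsClassicalWave F)

include hF

theorem contDiffAt (y : V) {t : ℝ} (ht : 0 < t) : ContDiffAt ℝ 2 F (y, t) :=
  hF.contDiffOn_two.contDiffAt (prod_mem_nhds univ_mem (Ioi_mem_nhds ht))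

theorem continuousOn_fderiv : ContinuousOn (fderiv ℝ F) (univ ×ˢ Ioi (0 : ℝ)) :=
  hF.contDiffOn_two.continuousOn_fderiv_of_isOpen (isOpen_univ.prod isOpen_Ioi) (by norm_num)

theorem continuousOn_fderiv_fderiv :
    ContinuousOn (fderiv ℝ (fderiv ℝ F)) (univ ×ˢ Ioi (0 : ℝ)) :=
  (hF.contDiffOn_two.fderiv_of_isOpen (m := 1) (isOpen_univ.prod isOpen_Ioi)
    (by norm_num)).continuousOn_fderiv_of_isOpen (isOpen_univ.prod isOpen_Ioi) le_rfl

theorem fderiv_fderiv_time_time (b : OrthonormalBasis ι ℝ V) (y : V) {t : ℝ} (ht : 0 < t) :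
    fderiv ℝ (fderiv ℝ F) (y, t) (0, 1) (0, 1) =
      ∑ i, fderiv ℝ (fderiv ℝ F) (y, t) (b i, 0) (b i, 0) := by
  have hwave := hF.wave_eq y t ht
  rw [iteratedDeriv_two_comp_prodMk (hF.contDiffAt y ht),
    laplacian_comp_prodMk (hF.contDiffAt y ht) b] at hwave
  simpa [iteratedFDeriv_two_apply] using hwave

theorem continuousOn_coneEnergyRate (b : OrthonormalBasis ι ℝ V) (x₀ : V) (R : ℝ) :
    ContinuousOn (coneEnergyRate b F x₀ R) (univ ×ˢ Ioi (0 : ℝ)) := by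
  have := hF.continuousOn_fderiv
  have := hF.continuousOn_fderiv_fderiv
  have : ContinuousOn (fun p => energyDensity b (fderiv ℝ F p)) (univ ×ˢ Ioi (0 : ℝ)) :=
    (continuous_energyDensity b).comp_continuousOn hF.continuousOn_fderiv
  unfold coneEnergyRate
  fun_prop

variable [MeasurableSpace V] [BorelSpace V]

theorem integral_coneEnergyRate_nonpos (b : OrthonormalBasis ι ℝ V) (x₀ : V) {R t : ℝ}
    (ht : t ∈ Ioo 0 R) : ∫ y, coneEnergyRate b F x₀ R (y, t) ≤ 0 := by
  have := continuous_comp_prodMk_left hF.continuousOn_fderiv ht.1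
  have := continuous_comp_prodMk_left hF.continuousOn_fderiv_fderiv ht.1
  have htR := Ioo_subset_Icc_self ht
  have hrate : Integrable fun y => coneEnergyRate b F x₀ R (y, t) :=
    integrable_of_conePart_eq_zero (x₀ := x₀) htR
      (continuous_comp_prodMk_left (hF.continuousOn_coneEnergyRate b x₀ R) ht.1)
      fun y hy => by simp [coneEnergyRate, hy]
  have hflux (e : V) : Integrable fun y => coneFluxDeriv F x₀ R (y, t) e := by
    refine integrable_of_conePart_eq_zero (x₀ := x₀) htR ?_ fun y hy => by simp [coneFluxDeriv, hy]
    unfold coneFluxDeriv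
    fun_prop
  calc ∫ y, coneEnergyRate b F x₀ R (y, t)
      ≤ ∫ y, ∑ i, coneFluxDeriv F x₀ R (y, t) (b i) :=
        integral_mono hrate (integrable_finsetSum _ fun i _ => hflux (b i)) fun y =>
          coneEnergyRate_le_sum_coneFluxDeriv (hF.contDiffAt y ht.1)
            (hF.fderiv_fderiv_time_time b y ht.1) x₀ ht.2
    _ = ∑ i, ∫ y, coneFluxDeriv F x₀ R (y, t) (b i) := integral_finsetSum _ fun i _ => hflux (b i)
    _ = 0 := Finset.sum_eq_zero fun i _ => integral_eq_zero_of_hasLineDerivAt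
        (integrable_of_conePart_eq_zero (x₀ := x₀) htR (by fun_prop) fun y hy => by simp [hy])
        (hflux (b i)) fun y =>
          hasLineDerivAt_conePart_sq_mul_flux (hF.contDiffAt y ht.1) x₀ R (b i)

end IsClassicalWave

end ClassicalWave

section DomainOfDependence

variable {V : Type*} [NormedAddCommGroup V] [InnerProductSpace ℝ V]

/-- The energy of `F` at time `s` weighted by `conePart x₀ R ^ 2`. The one-sided differential gives
it its meaning at the initial time `s = 0`. -/
noncomputable def coneEnergy {ι : Type*} [Fintype ι] [MeasureSpace V] (b : OrthonormalBasis ι ℝ V)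
    (F : V × ℝ → ℝ) (x₀ : V) (R s : ℝ) : ℝ :=
  ∫ y, conePart x₀ R (y, s) ^ 2 *
    energyDensity b (fderivWithin ℝ F (univ ×ˢ Ici (0 : ℝ)) (y, s))

theorem fderivWithin_univ_prod_Ici (F : V × ℝ → ℝ) (y : V) {s : ℝ} (hs : 0 < s) :
    fderivWithin ℝ F (univ ×ˢ Ici (0 : ℝ)) (y, s) = fderiv ℝ F (y, s) :=
  fderivWithin_of_mem_nhds (prod_mem_nhds univ_mem (Ici_mem_nhds hs))

namespace IsClassicalWave

variable [FiniteDimensional ℝ V] {F : V × ℝ → ℝ} (hF : IsClassicalWave F)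

include hF

theorem hasFDerivWithinAt (y : V) {s : ℝ} (hs : 0 ≤ s) :
    HasFDerivWithinAt F (fderivWithin ℝ F (univ ×ˢ Ici (0 : ℝ)) (y, s)) (univ ×ˢ Ici 0) (y, s) :=
  (hF.contDiffOn_one.differentiableOn (by simp) (y, s) ⟨mem_univ y, hs⟩).hasFDerivWithinAt

theorem continuousOn_fderivWithin :
    ContinuousOn (fderivWithin ℝ F (univ ×ˢ Ici (0 : ℝ))) (univ ×ˢ Ici 0) :=
  hF.contDiffOn_one.continuousOn_fderivWithin (uniqueDiffOn_univ.prod (uniqueDiffOn_Ici 0)) le_rfl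

theorem hasDerivWithinAt_time (y : V) {s : ℝ} (hs : 0 ≤ s) :
    HasDerivWithinAt (fun s => F (y, s)) (fderivWithin ℝ F (univ ×ˢ Ici (0 : ℝ)) (y, s) (0, 1))
      (Ici 0) s :=
  (hF.hasFDerivWithinAt y hs).comp_hasDerivWithinAt (f := fun s => (y, s)) s
    ((hasDerivAt_const s y).prodMk (hasDerivAt_id s)).hasDerivWithinAt fun _ hs => ⟨mem_univ y, hs⟩

theorem fderivWithin_zero_eq_zero {B : Set V} (hB : IsOpen B) (hval : ∀ y ∈ B, F (y, 0) = 0)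
    (hvel : ∀ y ∈ B, derivWithin (fun t => F (y, t)) (Ici 0) 0 = 0) {y : V} (hy : y ∈ B) :
    fderivWithin ℝ F (univ ×ˢ Ici (0 : ℝ)) (y, 0) = 0 := by
  have hspace : HasFDerivAt (fun z => F (z, 0))
      ((fderivWithin ℝ F (univ ×ˢ Ici (0 : ℝ)) (y, 0)).comp (.inl ℝ V ℝ)) y :=
    hasFDerivWithinAt_univ.1 <| (hF.hasFDerivWithinAt y le_rfl).comp (f := fun z => (z, (0 : ℝ))) y
      (hasFDerivAt_prodMk_left y 0).hasFDerivWithinAt fun z _ => ⟨mem_univ z, self_mem_Ici⟩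
  have hlocal : (fun z => F (z, 0)) =ᶠ[𝓝 y] fun _ => 0 :=
    eventually_of_mem (hB.mem_nhds hy) hval
  ext e
  · simpa using congrArg (· e)
      (hspace.unique ((hasFDerivAt_const (0 : ℝ) y).congr_of_eventuallyEq hlocal))
  · simpa using ((hF.hasDerivWithinAt_time y le_rfl).derivWithin
      (uniqueDiffWithinAt_Ici 0)).symm.trans (hvel y hy)

variable {ι : Type*} [Fintype ι] [MeasurableSpace V] [BorelSpace V]
  (b : OrthonormalBasis ι ℝ V) (x₀ : V) {R : ℝ}

theorem hasDerivAt_coneEnergy {t : ℝ} (ht : t ∈ Ioo 0 R) :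
    HasDerivAt (coneEnergy b F x₀ R) (∫ y, coneEnergyRate b F x₀ R (y, t)) t := by
  have hpos : (univ : Set V) ×ˢ Ioo 0 R ⊆ univ ×ˢ Ioi 0 :=
    prod_mono_right Ioo_subset_Ioi_self
  have : ContinuousOn (fun p => energyDensity b (fderiv ℝ F p)) (univ ×ˢ Ioo 0 R) :=
    (continuous_energyDensity b).comp_continuousOn (hF.continuousOn_fderiv.mono hpos)
  refine (hasDerivAt_integral_of_compact_support isOpen_Ioo (isCompact_closedBall x₀ R)
    (G := fun p => conePart x₀ R p ^ 2 * energyDensity b (fderiv ℝ F p)) (by fun_prop)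
    ((hF.continuousOn_coneEnergyRate b x₀ R).mono hpos)
    (fun y s hs => hasDerivAt_conePart_sq_mul_energyDensity b (hF.contDiffAt y hs.1) x₀ R)
    (fun y hy s hs => ?_) ht).congr_of_eventuallyEq ?_
  · rw [conePart_eq_zero (Ioo_subset_Icc_self hs) fun h => hy (Metric.ball_subset_closedBall h)]
    simp
  · filter_upwards [Ioi_mem_nhds ht.1] with s hs
    simp only [coneEnergy, fderivWithin_univ_prod_Ici F _ hs]

theorem continuousOn_coneEnergy : ContinuousOn (coneEnergy b F x₀ R) (Icc 0 R) := by
  refine continuousOn_integral_of_compact_support (isCompact_closedBall x₀ R) ?_ ?_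
  · have : ContinuousOn (fun q : ℝ × V => energyDensity b
        (fderivWithin ℝ F (univ ×ˢ Ici (0 : ℝ)) (q.2, q.1))) (Icc 0 R ×ˢ univ) :=
      (continuous_energyDensity b).comp_continuousOn <|
        hF.continuousOn_fderivWithin.comp (f := fun q : ℝ × V => (q.2, q.1)) (by fun_prop)
          fun q hq => ⟨mem_univ _, hq.1.1⟩
    simp only [Function.uncurry_def]
    fun_prop
  · intro s y hs hy
    rw [conePart_eq_zero hs fun h => hy (Metric.ball_subset_closedBall h)]
    simp

theorem antitoneOn_coneEnergy : AntitoneOn (coneEnergy b F x₀ R) (Icc 0 R) := by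
  refine antitoneOn_of_deriv_nonpos (convex_Icc 0 R) (hF.continuousOn_coneEnergy b x₀)
    ?_ ?_ <;> rw [interior_Icc] <;> intro s hs
  · exact (hF.hasDerivAt_coneEnergy b x₀ hs).differentiableAt.differentiableWithinAt
  · rw [(hF.hasDerivAt_coneEnergy b x₀ hs).deriv]
    exact hF.integral_coneEnergyRate_nonpos b x₀ hs

theorem fderiv_time_eq_zero_of_coneEnergy_nonpos {s : ℝ} (hs : s ∈ Ioo 0 R)
    (henergy : coneEnergy b F x₀ R s ≤ 0) {z : V} (hz : ‖z - x₀‖ < R - s) :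
    fderiv ℝ F (z, s) (0, 1) = 0 := by
  simp only [coneEnergy, fderivWithin_univ_prod_Ici F _ hs.1] at henergy
  have hnonneg (y : V) : 0 ≤ conePart x₀ R (y, s) ^ 2 * energyDensity b (fderiv ℝ F (y, s)) :=
    mul_nonneg (sq_nonneg _) (energyDensity_nonneg b _)
  have := continuous_comp_prodMk_left hF.continuousOn_fderiv hs.1
  have hcont : Continuous
      fun y => conePart x₀ R (y, s) ^ 2 * energyDensity b (fderiv ℝ F (y, s)) := by
    fun_prop
  have hint := integrable_of_conePart_eq_zero (μ := volume) (x₀ := x₀) (Ioo_subset_Icc_self hs)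
    hcont fun y hy => by simp [hy]
  have hzero := (hcont.ae_eq_iff_eq volume continuous_const).1
    ((integral_eq_zero_iff_of_nonneg hnonneg hint).1
      (henergy.antisymm (integral_nonneg hnonneg)))
  exact apply_time_eq_zero_of_energyDensity_eq_zero <|
    (mul_eq_zero.1 (congrFun hzero z)).resolve_left
      (pow_pos ((conePart_pos_iff hs.2.le).2 hz) 2).ne'

omit [MeasurableSpace V] [BorelSpace V] in
theorem eq_zero_in_lightCone (hval : ∀ y ∈ Metric.ball x₀ R, F (y, 0) = 0)
    (hvel : ∀ y ∈ Metric.ball x₀ R, derivWithin (fun t => F (y, t)) (Ici 0) 0 = 0)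
    {y : V} {t : ℝ} (ht : 0 ≤ t) (hy : ‖y - x₀‖ < R - t) : F (y, t) = 0 := by
  borelize V
  let b := stdOrthonormalBasis ℝ V
  have hinit : ∀ z ∈ Metric.ball x₀ R, fderivWithin ℝ F (univ ×ˢ Ici (0 : ℝ)) (z, 0) = 0 :=
    fun z hz => hF.fderivWithin_zero_eq_zero Metric.isOpen_ball hval hvel hz
  have hR : 0 < R := by linarith [norm_nonneg (y - x₀)]
  have hyball : y ∈ Metric.ball x₀ R := mem_ball_iff_norm.2 (by linarith)
  have henergy : coneEnergy b F x₀ R 0 = 0 := by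
    refine integral_eq_zero_of_ae (.of_forall fun z => ?_)
    by_cases hz : z ∈ Metric.ball x₀ R
    · simp [energyDensity, hinit z hz]
    · simp [conePart_eq_zero ⟨le_rfl, hR.le⟩ hz]
  rw [← hval y hyball]
  refine constant_of_has_deriv_right_zero (f := fun s => F (y, s)) (a := 0) (b := t)
    (fun s hs => ((hF.hasDerivWithinAt_time y hs.1).mono Icc_subset_Ici_self).continuousWithinAt)
    (fun s hs => ?_) t ⟨ht, le_rfl⟩
  refine ((hF.hasDerivWithinAt_time y hs.1).mono (Ici_subset_Ici.2 hs.1)).congr_deriv ?_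
  rcases hs.1.eq_or_lt with rfl | hpos
  · rw [hinit y hyball, zero_apply]
  · have hsR : s ∈ Ioo 0 R := ⟨hpos, by linarith [hs.2, norm_nonneg (y - x₀)]⟩
    rw [fderivWithin_univ_prod_Ici F y hpos]
    exact hF.fderiv_time_eq_zero_of_coneEnergy_nonpos b x₀ hsR
      (henergy ▸ hF.antitoneOn_coneEnergy b x₀ ⟨le_rfl, hR.le⟩ (Ioo_subset_Icc_self hsR) hpos.le)
      (by linarith [hs.2])

end IsClassicalWave

end DomainOfDependence

section WaveSolution

variable {n : ℕ} {f g f' g' : EuclideanSpace ℝ (Fin n) → ℝ}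
  {u u' : EuclideanSpace ℝ (Fin n) → ℝ → ℝ}

theorem IsWaveSolution.isClassicalWave (hu : IsWaveSolution f g u) :
    IsClassicalWave fun p : EuclideanSpace ℝ (Fin n) × ℝ => u p.1 p.2 where
  contDiffOn_two := hu.contDiffOn_two
  contDiffOn_one := hu.contDiffOn_one
  wave_eq y t ht := sub_eq_zero.1 (hu.wave_eq y t ht)

theorem IsWaveSolution.sub (hu : IsWaveSolution f g u) (hu' : IsWaveSolution f' g' u') :
    IsWaveSolution (fun x => f x - f' x) (fun x => g x - g' x) (fun x t => u x t - u' x t) where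
  contDiffOn_two := hu.contDiffOn_two.sub hu'.contDiffOn_two
  contDiffOn_one := hu.contDiffOn_one.sub hu'.contDiffOn_one
  wave_eq x t ht := by
    have htime {F : EuclideanSpace ℝ (Fin n) × ℝ → ℝ} (hF : IsClassicalWave F) :
        ContDiffAt ℝ 2 (fun s => F (x, s)) t := (hF.contDiffAt x ht).comp t (by fun_prop)
    have hspace {F : EuclideanSpace ℝ (Fin n) × ℝ → ℝ} (hF : IsClassicalWave F) :
        ContDiffAt ℝ 2 (fun y => F (y, t)) x :=
      (hF.contDiffAt x ht).comp (f := fun y => (y, t)) x (by fun_prop)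
    linear_combination
      iteratedDeriv_fun_sub (htime hu.isClassicalWave) (htime hu'.isClassicalWave) -
        (hspace hu.isClassicalWave).laplacian_sub (hspace hu'.isClassicalWave) +
        hu.wave_eq x t ht - hu'.wave_eq x t ht
  initial_value x := by rw [hu.initial_value, hu'.initial_value]
  initial_velocity x := by
    rw [← hu.initial_velocity, ← hu'.initial_velocity]
    exact derivWithin_fun_sub
      (hu.isClassicalWave.hasDerivWithinAt_time x le_rfl).differentiableWithinAt
      (hu'.isClassicalWave.hasDerivWithinAt_time x le_rfl).differentiableWithinAt

theorem IsWaveSolution.eq_in_lightCone (hu : IsWaveSolution f g u)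
    (hu' : IsWaveSolution f' g' u') {x₀ : EuclideanSpace ℝ (Fin n)} {R : ℝ}
    (hf : EqOn f f' (Metric.ball x₀ R)) (hg : EqOn g g' (Metric.ball x₀ R))
    {y : EuclideanSpace ℝ (Fin n)} {t : ℝ} (ht : 0 ≤ t) (hy : ‖y - x₀‖ < R - t) :
    u y t = u' y t :=
  sub_eq_zero.1 <| (hu.sub hu').isClassicalWave.eq_zero_in_lightCone x₀
    (fun z hz => ((hu.sub hu').initial_value z).trans (sub_eq_zero.2 (hf hz)))
    (fun z hz => ((hu.sub hu').initial_velocity z).trans (sub_eq_zero.2 (hg hz))) ht hy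

end WaveSolution

section EvenReflection

open scoped SchwartzMap

theorem exists_schwartzMap_eqOn_ball {V : Type*} [NormedAddCommGroup V] [InnerProductSpace ℝ V]
    [FiniteDimensional ℝ V] {f : V → ℝ} (hf : ContDiff ℝ ∞ f) (x : V) (R : ℝ) :
    ∃ g : 𝓢(V, ℝ), EqOn f g (Metric.ball x R) := by
  let χ : ContDiffBump x := ⟨max R 1, max R 1 + 1, by positivity, by linarith⟩
  refine ⟨(χ.hasCompactSupport.mul_right (f' := f)).toSchwartzMap (χ.contDiff.mul hf),
    fun y hy => ?_⟩
  have hyχ : y ∈ Metric.closedBall x χ.rIn :=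
    Metric.ball_subset_closedBall (Metric.ball_subset_ball (le_max_left R 1) hy)
  simp [χ.one_of_mem_closedBall hyχ]

/-- The extension of a function of `(x, t)`, `t ≥ 0`, to negative times by time reversal. For a wave
with zero initial velocity it is again a wave. -/
def evenReflection {V : Type*} (u : V → ℝ → ℝ) (p : V × ℝ) : ℝ := u p.1 |p.2|

theorem evenReflection_of_nonneg {V : Type*} (u : V → ℝ → ℝ) (y : V) {t : ℝ} (ht : 0 ≤ t) :
    evenReflection u (y, t) = u y t := by
  rw [evenReflection, abs_of_nonneg ht]

theorem eventually_norm_sub_lt_sub_abs {V : Type*} [NormedAddCommGroup V] (x : V) {t R : ℝ}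
    (ht : |t| < R) : ∀ᶠ p : V × ℝ in 𝓝 (x, t), ‖p.1 - x‖ < R - |p.2| := by
  refine (isOpen_lt (by fun_prop) (by fun_prop)).mem_nhds ?_
  simpa using ht

variable {n : ℕ} {f : EuclideanSpace ℝ (Fin n) → ℝ} {u : EuclideanSpace ℝ (Fin n) → ℝ → ℝ}

namespace IsWaveSolution

theorem evenReflection_eq_cosineWave (hu : IsWaveSolution f (fun _ => 0) u)
    {g : 𝓢(EuclideanSpace ℝ (Fin n), ℝ)} {x : EuclideanSpace ℝ (Fin n)} {R : ℝ}
    (hfg : EqOn f g (Metric.ball x R)) {p : EuclideanSpace ℝ (Fin n) × ℝ}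
    (hp : ‖p.1 - x‖ < R - |p.2|) : evenReflection u p = cosineWave g p := by
  rw [evenReflection, hu.eq_in_lightCone (isWaveSolution_cosineWave g) hfg (fun _ _ => rfl)
    (abs_nonneg p.2) hp]
  rcases abs_choice p.2 with habs | habs
  · rw [habs]
  · rw [habs, cosineWave_neg]

theorem contDiff_evenReflection (hu : IsWaveSolution f (fun _ => 0) u) (hf : ContDiff ℝ ∞ f) :
    ContDiff ℝ ∞ (evenReflection u) := by
  refine contDiff_iff_contDiffAt.2 fun ⟨x, t⟩ => ?_
  obtain ⟨g, hg⟩ := exists_schwartzMap_eqOn_ball hf x (|t| + 1)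
  refine (contDiff_cosineWave g).contDiffAt.congr_of_eventuallyEq ?_
  filter_upwards [eventually_norm_sub_lt_sub_abs x (lt_add_one |t|)] with p hp
  exact hu.evenReflection_eq_cosineWave hg hp

theorem sphericalMean_eq_sineAverage_evenReflection (hu : IsWaveSolution f (fun _ => 0) u)
    (hf : ContDiff ℝ ∞ f) {p : ℕ} (hn : n = p + 2) (x : EuclideanSpace ℝ (Fin n)) {r : ℝ}
    (hr : 0 ≤ r) :
    sphericalMean f x r = sineAverage p (fun t => evenReflection u (x, t)) r := by
  obtain ⟨g, hg⟩ := exists_schwartzMap_eqOn_ball hf x (r + 1)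
  have hmean : sphericalMean f x r = sphericalMean g x r := by
    refine congrArg (_ * ·) (integral_congr_ae (.of_forall fun y => hg ?_))
    simp [norm_smul, abs_of_nonneg hr]
  have hwave (θ : ℝ) : evenReflection u (x, r * sin θ) = cosineWave g (x, r * sin θ) := by
    refine hu.evenReflection_eq_cosineWave hg ?_
    have : r * |sin θ| ≤ r := mul_le_of_le_one_right hr (abs_sin_le_one θ)
    rw [sub_self, norm_zero, abs_mul, abs_of_nonneg hr]
    linarith
  rw [hmean, sphericalMean_eq_sineAverage_cosineWave g hn x hr]
  simp only [sineAverage, hwave]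

theorem evenReflection_eventuallyEq_zero (hu : IsWaveSolution f (fun _ => 0) u)
    {x : EuclideanSpace ℝ (Fin n)} (hx : x ∉ tsupport f) : evenReflection u =ᶠ[𝓝 (x, 0)] 0 := by
  obtain ⟨R, hR, hball⟩ := Metric.mem_nhds_iff.1
    (notMem_tsupport_iff_eventuallyEq.1 hx)
  filter_upwards [eventually_norm_sub_lt_sub_abs x (abs_zero.trans_lt hR)] with p hp
  exact hu.isClassicalWave.eq_zero_in_lightCone x
    (fun y hy => (hu.initial_value y).trans (hball hy)) (fun y _ => hu.initial_velocity y)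
    (abs_nonneg p.2) hp

end IsWaveSolution

end EvenReflection

section WaveProfiles

theorem hasLineDerivAt_comp_prodMk {V : Type*} [NormedAddCommGroup V] [NormedSpace ℝ V]
    {w : V × ℝ → ℝ} {x : V} {t : ℝ} (hw : DifferentiableAt ℝ w (x, t)) (v : V) :
    HasLineDerivAt ℝ (fun y => w (y, t)) (fderiv ℝ w (x, t) (v, 0)) x v := by
  simpa using (hasFDerivAt_comp_prodMk_left hw).hasLineDerivAt v

variable {n : ℕ} {f : EuclideanSpace ℝ (Fin n) → ℝ} {u : EuclideanSpace ℝ (Fin n) → ℝ → ℝ}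

namespace IsWaveSolution

variable (hu : IsWaveSolution f (fun _ => 0) u) (hf : ContDiff ℝ ∞ f)
  (x v : EuclideanSpace ℝ (Fin n))

include hu

include hf in
theorem hasLineDerivAt {t : ℝ} (ht : 0 ≤ t) :
    HasLineDerivAt ℝ (fun y => u y t) (fderiv ℝ (evenReflection u) (x, t) (v, 0)) x v := by
  simpa only [evenReflection_of_nonneg u _ ht] using hasLineDerivAt_comp_prodMk
    ((hu.contDiff_evenReflection hf).differentiable (by simp) (x, t)) v

include hf in
theorem hasLineDerivAt_sphericalMean {p : ℕ} (hn : n = p + 2) {r : ℝ} (hr : 0 ≤ r) :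
    HasLineDerivAt ℝ (fun y => sphericalMean f y r)
      (sineAverage p (fun t => fderiv ℝ (evenReflection u) (x, t) (v, 0)) r) x v := by
  simpa only [hu.sphericalMean_eq_sineAverage_evenReflection hf hn _ hr] using
    hasLineDerivAt_sineAverage ((hu.contDiff_evenReflection hf).of_le (by simp)) p r x v

include hf in
theorem contDiff_fderiv_evenReflection :
    ContDiff ℝ ∞ fun t => fderiv ℝ (evenReflection u) (x, t) (v, 0) :=
  (((hu.contDiff_evenReflection hf).fderiv_right (m := ∞) (by simp)).comp
    (contDiff_prodMk_right x)).clm_apply contDiff_const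

theorem fderiv_evenReflection_eventuallyEq_zero (hx : x ∉ tsupport f) :
    (fun t => fderiv ℝ (evenReflection u) (x, t) (v, 0)) =ᶠ[𝓝 0] 0 := by
  have hzero := (hu.evenReflection_eventuallyEq_zero hx).fderiv (𝕜 := ℝ)
  filter_upwards [(Continuous.prodMk_right x).continuousAt.eventually hzero] with t ht
  simp [ht, Pi.zero_def]

end IsWaveSolution

end WaveProfiles
end WaveAbel

theorem mainTheorem8_general (n : ℕ) (hn : 2 ≤ n) (hn_even : Even n)
    (f : EuclideanSpace ℝ (Fin n) → ℝ) (hf_smooth : ContDiff ℝ ∞ f)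
    (u : EuclideanSpace ℝ (Fin n) → ℝ → ℝ) (hu : WaveAbel.IsWaveSolution f (fun _ => 0) u)
    (x v : EuclideanSpace ℝ (Fin n)) :
    (ContDiffOn ℝ ∞ (WaveAbel.sphericalMean f x) (Ioi 0) ∧
      (∀ r, 0 < r → LineDifferentiableAt ℝ (fun y => WaveAbel.sphericalMean f y r) x v) ∧
      ContDiffOn ℝ ∞ (WaveAbel.spatialDeriv v (WaveAbel.sphericalMean f) x) (Ioi 0) ∧
      ContDiffOn ℝ ∞ (u x) (Ioi 0) ∧
      (∀ t, 0 < t → LineDifferentiableAt ℝ (fun y => u y t) x v) ∧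
      ContDiffOn ℝ ∞ (WaveAbel.spatialDeriv v u x) (Ioi 0)) ∧
    ∀ r : ℝ, 0 < r →
      (WaveAbel.SatisfiesAbelIdentity n ((n - 2) / 2) (u x) (WaveAbel.sphericalMean f x) r ∧
        WaveAbel.SatisfiesAbelIdentity n ((n - 2) / 2) (WaveAbel.spatialDeriv v u x)
          (WaveAbel.spatialDeriv v (WaveAbel.sphericalMean f) x) r) ∧
      (x ∉ tsupport f →
        WaveAbel.SatisfiesAbelIdentity n (n - 2) (WaveAbel.derivInvMul^[(n - 2) / 2] (u x))
            (WaveAbel.sphericalMean f x) r ∧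
          WaveAbel.SatisfiesAbelIdentity n (n - 2)
            (WaveAbel.derivInvMul^[(n - 2) / 2] (WaveAbel.spatialDeriv v u x))
            (WaveAbel.spatialDeriv v (WaveAbel.sphericalMean f) x) r) := by
  obtain ⟨m, rfl⟩ : ∃ m, n = 2 * m + 2 := ⟨n / 2 - 1, by grind⟩
  simp only [Nat.add_sub_cancel, Nat.mul_div_cancel_left _ two_pos]
  have hlineU {t : ℝ} (ht : 0 < t) := hu.hasLineDerivAt hf_smooth x v ht.le
  have hlineN {r : ℝ} (hr : 0 < r) := hu.hasLineDerivAt_sphericalMean hf_smooth x v rfl hr.le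
  have hU : EqOn (u x) (fun t => WaveAbel.evenReflection u (x, t)) (Ioi 0) := fun t ht =>
    (WaveAbel.evenReflection_of_nonneg u x (le_of_lt ht)).symm
  have hN : EqOn (WaveAbel.sphericalMean f x) _ (Ioi 0) := fun r hr =>
    hu.sphericalMean_eq_sineAverage_evenReflection hf_smooth rfl x (le_of_lt hr)
  have hDU : EqOn (WaveAbel.spatialDeriv v u x) _ (Ioi 0) := fun t ht => (hlineU ht).lineDeriv
  have hDN : EqOn (WaveAbel.spatialDeriv v (WaveAbel.sphericalMean f) x) _ (Ioi 0) :=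
    fun r hr => (hlineN hr).lineDeriv
  have hh := (hu.contDiff_evenReflection hf_smooth).comp (contDiff_prodMk_right x)
  have hDh := hu.contDiff_fderiv_evenReflection hf_smooth x v
  refine ⟨⟨(WaveAbel.contDiff_sineAverage hh _).contDiffOn.congr hN,
    fun r hr => (hlineN hr).lineDifferentiableAt,
    (WaveAbel.contDiff_sineAverage hDh _).contDiffOn.congr hDN, hh.contDiffOn.congr hU,
    fun t ht => (hlineU ht).lineDifferentiableAt, hDh.contDiffOn.congr hDU⟩,
    fun r hr => ⟨⟨?_, ?_⟩, fun hx => ⟨?_, ?_⟩⟩⟩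
  · exact WaveAbel.satisfiesAbelIdentity_of_eqOn (hh.of_le (by simp)) m hU hN hr
  · exact WaveAbel.satisfiesAbelIdentity_of_eqOn (hDh.of_le (by simp)) m hDU hDN hr
  · exact WaveAbel.satisfiesAbelIdentity_iterate_of_eqOn hh
      ((Continuous.prodMk_right x).continuousAt.eventually
        (hu.evenReflection_eventuallyEq_zero hx)) m hU hN hr
  · exact WaveAbel.satisfiesAbelIdentity_iterate_of_eqOn hDh
      (hu.fderiv_evenReflection_eventuallyEq_zero x v hx) m hDU hDN hr

theorem mainTheorem8 (n : ℕ) (hn : 2 ≤ n) (hn_even : Even n)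
    (Ω : Set (EuclideanSpace ℝ (Fin n))) (hΩ : IsOpen Ω)
    (f : EuclideanSpace ℝ (Fin n) → ℝ) (hf_smooth : ContDiff ℝ ∞ f)
    (hf_compact : HasCompactSupport f) (hf_supp : tsupport f ⊆ Ω)
    (u : EuclideanSpace ℝ (Fin n) → ℝ → ℝ) (hu : WaveAbel.IsWaveSolution f (fun _ => 0) u)
    (x : EuclideanSpace ℝ (Fin n)) (hx : x ∈ frontier Ω) (v : EuclideanSpace ℝ (Fin n)) :
    -- all derivatives that occur below exist
    (ContDiffOn ℝ ∞ (WaveAbel.sphericalMean f x) (Ioi 0) ∧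
      (∀ r, 0 < r → LineDifferentiableAt ℝ (fun y => WaveAbel.sphericalMean f y r) x v) ∧
      ContDiffOn ℝ ∞ (WaveAbel.spatialDeriv v (WaveAbel.sphericalMean f) x) (Ioi 0) ∧
      ContDiffOn ℝ ∞ (u x) (Ioi 0) ∧
      (∀ t, 0 < t → LineDifferentiableAt ℝ (fun y => u y t) x v) ∧
      ContDiffOn ℝ ∞ (WaveAbel.spatialDeriv v u x) (Ioi 0)) ∧
    ∀ r : ℝ, 0 < r →
      (IntervalIntegrable (fun t => u x t / √(r ^ 2 - t ^ 2)) volume 0 r ∧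
        (WaveAbel.invMulDeriv^[(n - 2) / 2])
            (fun s => s ^ (n - 2) * WaveAbel.sphericalMean f x s) r =
          2 * (n‼ : ℝ) / (Real.pi * n) * ∫ t in (0 : ℝ)..r, u x t / √(r ^ 2 - t ^ 2)) ∧
      (IntervalIntegrable (fun t => WaveAbel.spatialDeriv v u x t / √(r ^ 2 - t ^ 2)) volume 0 r ∧
        (WaveAbel.invMulDeriv^[(n - 2) / 2])
            (fun s => s ^ (n - 2) * WaveAbel.spatialDeriv v (WaveAbel.sphericalMean f) x s) r =
          2 * (n‼ : ℝ) / (Real.pi * n) *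
            ∫ t in (0 : ℝ)..r, WaveAbel.spatialDeriv v u x t / √(r ^ 2 - t ^ 2)) ∧
      (IntervalIntegrable
          (fun t => (WaveAbel.derivInvMul^[(n - 2) / 2]) (u x) t / √(r ^ 2 - t ^ 2)) volume 0 r ∧
        (WaveAbel.invMulDeriv^[n - 2])
            (fun s => s ^ (n - 2) * WaveAbel.sphericalMean f x s) r =
          2 * (n‼ : ℝ) / (Real.pi * n) *
            ∫ t in (0 : ℝ)..r,
              (WaveAbel.derivInvMul^[(n - 2) / 2]) (u x) t / √(r ^ 2 - t ^ 2)) ∧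
      (IntervalIntegrable
          (fun t => (WaveAbel.derivInvMul^[(n - 2) / 2]) (WaveAbel.spatialDeriv v u x) t /
            √(r ^ 2 - t ^ 2)) volume 0 r ∧
        (WaveAbel.invMulDeriv^[n - 2])
            (fun s => s ^ (n - 2) * WaveAbel.spatialDeriv v (WaveAbel.sphericalMean f) x s) r =
          2 * (n‼ : ℝ) / (Real.pi * n) *
            ∫ t in (0 : ℝ)..r,
              (WaveAbel.derivInvMul^[(n - 2) / 2]) (WaveAbel.spatialDeriv v u x) t /
                √(r ^ 2 - t ^ 2)) := by
  obtain ⟨hreg, habel⟩ := mainTheorem8_general n hn hn_even f hf_smooth u hu x v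
  have hxΩ : x ∉ Ω := (hΩ.frontier_eq ▸ hx).2
  refine ⟨hreg, fun r hr => ?_⟩
  obtain ⟨⟨hU, hDU⟩, hder⟩ := habel r hr
  obtain ⟨hU', hDU'⟩ := hder fun hxf => hxΩ (hf_supp hxf)
  exact ⟨hU, hDU, hU', hDU'⟩
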